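/- Let $d\ge 1$ be square free, $q=e^{2\pi i/d}$, and let $\zeta\in\mathbb C$ satisfy $\zeta^2=q$ and $\zeta^{d^2}=1$. For $m\in\mathbb N\cup\{\infty\}$ let $PF_m$ be the parafermion algebra of degree $d$, i.e. the complex $*$-algebra generated by $c_1,c_2,\dots$ ($m$ generators; $c_j$ for all $j\ge1$ if $m=\infty$) subject to $c_jc_k=q\,c_kc_j$ for $j<k$, $c_j^d=1$ and $c_j^*=c_j^{-1}$. It is $\mathbb Z_d$-graded with $\deg c_j=1$. A state on $PF_m$ is a linear functional $\varphi$ with $\varphi(1)=1$ and $\varphi(x^*x)\ge0$ for all $x$; it is neutral if $\varphi(x)=0$ for every homogeneous $x$ with $\deg x\ne0$ in $\mathbb Z_d$. Put $\omega=d^{-1/2}\sum_{j=0}^{d-1}\zeta^{j^2}$ (a number of modulus one) and define the two-string braids $b^{(2)}_k=\frac{\omega^{1/2}}{\sqrt d}\sum_{i=0}^{d-1}c_k^{\,i}c_{k+1}^{-i}$ and the four-string braids $b_j=b^{(2)}_{2j}\,b^{(2)}_{2j-1}\,b^{(2)}_{2j+1}\,b^{(2)}_{2j}$ for $j\ge1$;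 these are unitary elements of $PF_\infty$. Let $\mathbb B_\infty$ be the group of unitaries generated by all $b_j$, and call a state $\varphi$ on $PF_\infty$ braid-invariant if $\varphi(bxb^{-1})=\varphi(x)$ for all $b\in\mathbb B_\infty$ and $x\in PF_\infty$. For $k\ge1$ let $\iota_k:PF_2\to PF_\infty$ be the embedding $c_1\mapsto c_{2k-1}$, $c_2\mapsto c_{2k}$. For a state $\rho$ on $PF_2$, a state $\psi$ on $PF_\infty$ is the product state $\rho^{\otimes\infty}$ if $\psi(\iota_1(x_1)\iota_2(x_2)\cdots\iota_n(x_n))=\prod_{k=1}^n\rho(x_k)$ for all $n$ and all $x_1,\dots,x_n\in PF_2$. **Theorem.** Every braid-invariant state $\varphi$ on $PF_\infty$ is neutral. Moreover, $\varphi$ lies in the weak* closure (the closure for pointwise convergence on $PF_\infty$) of the set of convex combinations of product states $\rho^{\otimes\infty}$ with $\rho$ a neutral state on $PF_2$. -/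

import Mathlib

open scoped ComplexOrder

/-- Exponent of `q` picked up when the product of two ordered monomials
`∏ j, c j ^ m j` and `∏ j, c j ^ n j` is put in increasing order: for `j < k`, moving `c j ^ n j`
to the left past `c k ^ m k` gives the factor `q ^ (-(m k * n j))`. -/
def reorderExponent {d : ℕ} {ι : Type} [LinearOrder ι] (m n : ι →₀ ZMod d) : ZMod d :=
  -(m.sum fun k a => n.sum fun j b => if j < k then a * b else 0)

/-- The parafermion algebra of degree `d` with generators `c j`, `j : ι` (`ι` linearly ordered):
the `*`-algebra over `ℂ` with unitary generators and relations
`c j * c k = q • (c k * c j)` for `j < k` and `c j ^ d = 1`, where `q = exp (2 π i / d)`.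
It is realised on its basis of ordered monomials `∏ j, c j ^ m j` (increasing order of `j`, from
left to right), which are indexed by the finitely supported exponents `m : ι →₀ ZMod d`. -/
def PF (d : ℕ) (ι : Type) : Type := (ι →₀ ZMod d) →₀ ℂ

namespace PF

variable {d : ℕ} {ι : Type}

noncomputable instance : AddCommGroup (PF d ι) :=
  inferInstanceAs (AddCommGroup ((ι →₀ ZMod d) →₀ ℂ))

noncomputable instance : Module ℂ (PF d ι) :=
  inferInstanceAs (Module ℂ ((ι →₀ ZMod d) →₀ ℂ))

/-- `monomial m a` is `a` times the ordered monomial `∏ j, c j ^ m j`. -/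
noncomputable def monomial (m : ι →₀ ZMod d) (a : ℂ) : PF d ι := Finsupp.single m a

noncomputable instance : One (PF d ι) where
  one := monomial 0 1

theorem one_def : (1 : PF d ι) = monomial 0 1 := rfl

theorem monomial_add (m : ι →₀ ZMod d) (a b : ℂ) :
    monomial m (a + b) = monomial m a + monomial m b := Finsupp.single_add m a b

theorem monomial_zero (m : ι →₀ ZMod d) : monomial m 0 = 0 := Finsupp.single_zero m

theorem smul_monomial (m : ι →₀ ZMod d) (a b : ℂ) : a • monomial m b = monomial m (a * b) :=
  Finsupp.smul_single' a m b

@[elab_as_elim]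
theorem induction_on {p : PF d ι → Prop} (x : PF d ι) (h0 : p 0)
    (hadd : ∀ x y, p x → p y → p (x + y)) (hm : ∀ m a, p (monomial m a)) : p x :=
  Finsupp.induction_linear x h0 hadd hm

section Ring

variable [LinearOrder ι]

theorem reorderExponent_add_left (m m' n : ι →₀ ZMod d) :
    reorderExponent (m + m') n = reorderExponent m n + reorderExponent m' n := by
  unfold reorderExponent
  rw [Finsupp.sum_add_index', neg_add]
  · intro k
    simp
  · intro k a b
    rw [← Finsupp.sum_add]
    refine Finsupp.sum_congr fun j _ => ?_
    split_ifs <;> ring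

theorem reorderExponent_add_right (m n n' : ι →₀ ZMod d) :
    reorderExponent m (n + n') = reorderExponent m n + reorderExponent m n' := by
  unfold reorderExponent
  rw [← neg_add, ← Finsupp.sum_add]
  congr 1
  refine Finsupp.sum_congr fun k _ => ?_
  rw [Finsupp.sum_add_index']
  · intro j
    simp
  · intro j a b
    split_ifs <;> ring

theorem reorderExponent_zero_left (n : ι →₀ ZMod d) : reorderExponent 0 n = 0 := by
  simp [reorderExponent]

theorem reorderExponent_zero_right (n : ι →₀ ZMod d) : reorderExponent n 0 = 0 := by
  simp [reorderExponent]

theorem reorderExponent_neg_left (m n : ι →₀ ZMod d) :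
    reorderExponent (-m) n = -reorderExponent m n := by
  rw [eq_neg_iff_add_eq_zero, ← reorderExponent_add_left, neg_add_cancel,
    reorderExponent_zero_left]

theorem reorderExponent_neg_right (m n : ι →₀ ZMod d) :
    reorderExponent m (-n) = -reorderExponent m n := by
  rw [eq_neg_iff_add_eq_zero, ← reorderExponent_add_right, neg_add_cancel,
    reorderExponent_zero_right]

theorem reorderExponent_single (j k : ι) (a b : ZMod d) :
    reorderExponent (Finsupp.single k a) (Finsupp.single j b) = if j < k then -(a * b) else 0 := by
  unfold reorderExponent
  rw [Finsupp.sum_single_index, Finsupp.sum_single_index]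
  · split_ifs <;> simp
  · simp
  · simp

variable [NeZero d]

/-- The product on coefficients; `ZMod.stdAddChar a` is `q ^ a` with `q = exp (2 π i / d)`. -/
noncomputable def mulCoeff (x y : (ι →₀ ZMod d) →₀ ℂ) : (ι →₀ ZMod d) →₀ ℂ :=
  x.sum fun m a => y.sum fun n b =>
    Finsupp.single (m + n) (a * b * ZMod.stdAddChar (reorderExponent m n))

theorem mulCoeff_add_left (x y z : (ι →₀ ZMod d) →₀ ℂ) :
    mulCoeff (x + y) z = mulCoeff x z + mulCoeff y z := by
  refine Finsupp.sum_add_index' ?_ ?_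
  · intro m
    simp
  · intro m a b
    rw [← Finsupp.sum_add]
    refine Finsupp.sum_congr fun n _ => ?_
    rw [add_mul, add_mul, Finsupp.single_add]

theorem mulCoeff_add_right (x y z : (ι →₀ ZMod d) →₀ ℂ) :
    mulCoeff x (y + z) = mulCoeff x y + mulCoeff x z := by
  unfold mulCoeff
  rw [← Finsupp.sum_add]
  refine Finsupp.sum_congr fun m _ => ?_
  refine Finsupp.sum_add_index' ?_ ?_
  · intro n
    simp
  · intro n a b
    rw [mul_add, add_mul, Finsupp.single_add]

theorem mulCoeff_single (m n : ι →₀ ZMod d) (a b : ℂ) :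
    mulCoeff (Finsupp.single m a) (Finsupp.single n b) =
      Finsupp.single (m + n) (a * b * ZMod.stdAddChar (reorderExponent m n)) := by
  unfold mulCoeff
  rw [Finsupp.sum_single_index, Finsupp.sum_single_index]
  · simp
  · simp

noncomputable instance : Mul (PF d ι) where
  mul x y := mulCoeff x y

theorem monomial_mul_monomial (m n : ι →₀ ZMod d) (a b : ℂ) :
    monomial m a * monomial n b =
      monomial (m + n) (a * b * ZMod.stdAddChar (reorderExponent m n)) :=
  mulCoeff_single m n a b

protected theorem add_mul' (x y z : PF d ι) : (x + y) * z = x * z + y * z :=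
  mulCoeff_add_left x y z

protected theorem mul_add' (x y z : PF d ι) : x * (y + z) = x * y + x * z :=
  mulCoeff_add_right x y z

protected theorem zero_mul' (x : PF d ι) : 0 * x = 0 := by
  have h := PF.add_mul' 0 0 x
  rw [add_zero] at h
  exact left_eq_add.mp h

protected theorem mul_zero' (x : PF d ι) : x * 0 = 0 := by
  have h := PF.mul_add' x 0 0
  rw [add_zero] at h
  exact left_eq_add.mp h

noncomputable instance : Ring (PF d ι) where
  __ := (inferInstance : AddCommGroup (PF d ι))
  left_distrib := PF.mul_add'
  right_distrib := PF.add_mul'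
  zero_mul := PF.zero_mul'
  mul_zero := PF.mul_zero'
  one_mul x := by
    refine induction_on x (PF.mul_zero' _) (fun x y hx hy => ?_) (fun m a => ?_)
    · rw [PF.mul_add', hx, hy]
    · simp [one_def, monomial_mul_monomial, reorderExponent_zero_left]
  mul_one x := by
    refine induction_on x (PF.zero_mul' _) (fun x y hx hy => ?_) (fun m a => ?_)
    · rw [PF.add_mul', hx, hy]
    · simp [one_def, monomial_mul_monomial, reorderExponent_zero_right]
  mul_assoc x y z := by
    refine induction_on x ?_ (fun x x' hx hx' => ?_) (fun m a => ?_)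
    · simp only [PF.zero_mul']
    · simp only [PF.add_mul', hx, hx']
    refine induction_on y ?_ (fun y y' hy hy' => ?_) (fun n b => ?_)
    · simp only [PF.zero_mul', PF.mul_zero']
    · simp only [PF.add_mul', PF.mul_add', hy, hy']
    refine induction_on z ?_ (fun z z' hz hz' => ?_) (fun l e => ?_)
    · simp only [PF.mul_zero']
    · simp only [PF.mul_add', hz, hz']
    simp only [monomial_mul_monomial, reorderExponent_add_left, reorderExponent_add_right,
      AddChar.map_add_eq_mul, add_assoc]
    congr 1
    ring

noncomputable instance : Algebra ℂ (PF d ι) :=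
  Algebra.ofModule
    (fun r x y => by
      refine induction_on x (by simp) (fun x x' hx hx' => ?_) (fun m a => ?_)
      · simp only [smul_add, add_mul, hx, hx']
      refine induction_on y (by simp) (fun y y' hy hy' => ?_) (fun n b => ?_)
      · simp only [smul_add, mul_add, hy, hy']
      simp only [smul_monomial, monomial_mul_monomial, mul_assoc])
    (fun r x y => by
      refine induction_on x (by simp) (fun x x' hx hx' => ?_) (fun m a => ?_)
      · simp only [smul_add, add_mul, hx, hx']
      refine induction_on y (by simp) (fun y y' hy hy' => ?_) (fun n b => ?_)
      · simp only [smul_add, mul_add, hy, hy']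
      simp only [smul_monomial, monomial_mul_monomial]
      congr 1
      ring)

/-- The conjugate-linear involution on coefficients, sending each ordered monomial to its
inverse. -/
noncomputable def starCoeff (x : (ι →₀ ZMod d) →₀ ℂ) : (ι →₀ ZMod d) →₀ ℂ :=
  x.sum fun m a => Finsupp.single (-m) (star a * ZMod.stdAddChar (reorderExponent m m))

theorem starCoeff_add (x y : (ι →₀ ZMod d) →₀ ℂ) :
    starCoeff (x + y) = starCoeff x + starCoeff y := by
  refine Finsupp.sum_add_index' ?_ ?_
  · intro m
    simp
  · intro m a b
    rw [star_add, add_mul, Finsupp.single_add]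

theorem starCoeff_single (m : ι →₀ ZMod d) (a : ℂ) :
    starCoeff (Finsupp.single m a) =
      Finsupp.single (-m) (star a * ZMod.stdAddChar (reorderExponent m m)) := by
  unfold starCoeff
  rw [Finsupp.sum_single_index]
  simp

noncomputable instance : Star (PF d ι) where
  star x := starCoeff x

theorem star_monomial (m : ι →₀ ZMod d) (a : ℂ) :
    star (monomial m a) = monomial (-m) (star a * ZMod.stdAddChar (reorderExponent m m)) :=
  starCoeff_single m a

protected theorem star_add' (x y : PF d ι) : star (x + y) = star x + star y :=
  starCoeff_add x y

protected theorem star_zero' : star (0 : PF d ι) = 0 := by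
  have h := PF.star_add' (0 : PF d ι) 0
  rw [add_zero] at h
  exact left_eq_add.mp h

theorem star_stdAddChar (a : ZMod d) :
    star (ZMod.stdAddChar a : ℂ) = ZMod.stdAddChar (-a) :=
  (AddChar.map_neg_eq_conj (ZMod.stdAddChar (N := d)) a).symm

noncomputable instance : StarRing (PF d ι) where
  star_involutive x := by
    refine induction_on x ?_ (fun x y hx hy => ?_) (fun m a => ?_)
    · rw [PF.star_zero', PF.star_zero']
    · rw [PF.star_add', PF.star_add', hx, hy]
    · rw [star_monomial, star_monomial, star_mul', star_star, star_stdAddChar, mul_assoc,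
        ← AddChar.map_add_eq_mul, reorderExponent_neg_left, reorderExponent_neg_right]
      simp
  star_add := PF.star_add'
  star_mul x y := by
    refine induction_on x ?_ (fun x x' hx hx' => ?_) (fun m a => ?_)
    · rw [zero_mul, PF.star_zero', mul_zero]
    · rw [add_mul, PF.star_add', PF.star_add', hx, hx', mul_add]
    refine induction_on y ?_ (fun y y' hy hy' => ?_) (fun n b => ?_)
    · rw [mul_zero, PF.star_zero', zero_mul]
    · rw [mul_add, PF.star_add', PF.star_add', hy, hy', add_mul]
    simp only [star_monomial, monomial_mul_monomial, star_mul', star_stdAddChar, neg_add,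
      reorderExponent_add_left, reorderExponent_add_right, reorderExponent_neg_left,
      reorderExponent_neg_right, AddChar.map_add_eq_mul, neg_neg]
    rw [add_comm (-m) (-n)]
    congr 1
    have h : (ZMod.stdAddChar (-reorderExponent m n) : ℂ) * ZMod.stdAddChar (reorderExponent m n)
        = 1 := by
      rw [← AddChar.map_add_eq_mul]
      simp
    linear_combination (star a * star b * ZMod.stdAddChar (reorderExponent m m) *
      ZMod.stdAddChar (reorderExponent n n) * ZMod.stdAddChar (reorderExponent n m)) * h

instance : StarModule ℂ (PF d ι) where
  star_smul r x := by
    refine induction_on x ?_ (fun x x' hx hx' => ?_) (fun m a => ?_)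
    · rw [smul_zero, PF.star_zero', smul_zero]
    · rw [smul_add, PF.star_add', PF.star_add', hx, hx', smul_add]
    · rw [smul_monomial, star_monomial, star_monomial, smul_monomial, star_mul', mul_assoc]

/-- The parafermion generators. -/
noncomputable def c (j : ι) : PF d ι := monomial (Finsupp.single j 1) 1

theorem c_pow (j : ι) (i : ℕ) : (c j : PF d ι) ^ i = monomial (Finsupp.single j (i : ZMod d)) 1 := by
  induction i with
  | zero => simp [one_def]
  | succ i ih =>
    rw [pow_succ, ih, c, monomial_mul_monomial, reorderExponent_single, ← Finsupp.single_add]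
    simp

/-! The parafermion relations. -/

theorem c_mul_c {j k : ι} (h : j < k) :
    (c j * c k : PF d ι) = Complex.exp (2 * Real.pi * Complex.I / d) • (c k * c j) := by
  have hq : (ZMod.stdAddChar (1 : ZMod d) : ℂ) = Complex.exp (2 * Real.pi * Complex.I / d) := by
    have := ZMod.stdAddChar_coe (N := d) 1
    simpa using this
  simp only [c, monomial_mul_monomial, reorderExponent_single, smul_monomial, h, h.not_gt, if_true,
    if_false, ← hq, add_comm (Finsupp.single k (1 : ZMod d))]
  congr 1
  rw [mul_left_comm, ← AddChar.map_add_eq_mul]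
  simp

theorem c_pow_degree (j : ι) : (c j : PF d ι) ^ d = 1 := by
  simp [c_pow, one_def]

theorem monomial_mem_unitary (m : ι →₀ ZMod d) : (monomial m 1 : PF d ι) ∈ unitary (PF d ι) := by
  rw [Unitary.mem_iff]
  simp only [star_monomial, monomial_mul_monomial, reorderExponent_neg_left,
    reorderExponent_neg_right, one_def]
  simp [← AddChar.map_add_eq_mul]

theorem c_mem_unitary (j : ι) : (c j : PF d ι) ∈ unitary (PF d ι) := monomial_mem_unitary _

/-- The parafermions generate the algebra. -/
theorem adjoin_range_c : Algebra.adjoin ℂ (Set.range (c : ι → PF d ι)) = ⊤ := by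
  have key (m : ι →₀ ZMod d) :
      (monomial m 1 : PF d ι) ∈ Algebra.adjoin ℂ (Set.range (c : ι → PF d ι)) := by
    induction m using Finsupp.induction_on_max with
    | zero => exact one_mem _
    | single_add k a m hm ha ih =>
      have hk : (c k : PF d ι) ^ a.val ∈ Algebra.adjoin ℂ (Set.range (c : ι → PF d ι)) :=
        pow_mem (Algebra.subset_adjoin (Set.mem_range_self k)) _
      have h0 : reorderExponent m (Finsupp.single k a) = 0 := by
        unfold reorderExponent
        rw [neg_eq_zero]
        refine Finset.sum_eq_zero fun j hj => ?_
        refine (Finsupp.sum_single_index (by simp)).trans ?_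
        rw [if_neg (hm j hj).not_gt]
      have h : monomial (Finsupp.single k a + m) 1 = monomial m 1 * (c k : PF d ι) ^ a.val := by
        rw [c_pow, monomial_mul_monomial, ZMod.natCast_zmod_val, h0, add_comm]
        simp
      rw [h]
      exact mul_mem ih hk
  refine eq_top_iff.mpr fun x _ => ?_
  induction x using induction_on with
  | h0 => exact zero_mem _
  | hadd x y hx hy => exact add_mem (hx trivial) (hy trivial)
  | hm m a =>
    have h := Subalgebra.smul_mem _ (key m) a
    rwa [smul_monomial, mul_one] at h

end Ring

/-- The component of charge `k`: the span of the monomials of degree `k` modulo `d`. -/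
noncomputable def chargePart (d : ℕ) (ι : Type) (k : ZMod d) : Submodule ℂ (PF d ι) :=
  Submodule.span ℂ {x | ∃ m : ι →₀ ZMod d, (m.sum fun _ a => a) = k ∧ x = monomial m 1}

/-- The embedding that relabels generators along an order embedding, `c j ↦ c (f j)`. -/
noncomputable def relabel {κ : Type} [LinearOrder ι] [LinearOrder κ] (f : ι ↪o κ) :
    PF d ι →ₗ[ℂ] PF d κ :=
  Finsupp.lmapDomain ℂ ℂ (Finsupp.mapDomain (M := ZMod d) f)

/-- The two generators of the `k`-th pair of strings, `c (2 * k)` and `c (2 * k + 1)`. -/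
noncomputable def pairIndex (k : ℕ) : Fin 2 ↪o ℕ :=
  OrderEmbedding.ofStrictMono (fun i : Fin 2 => 2 * k + (i : ℕ)) fun _ _ h =>
    Nat.add_lt_add_left h (2 * k)

/-- The embedding of `PF_2` into `PF_∞` as the `k`-th pair (strings are numbered from `0`). -/
noncomputable def pairEmbedding (k : ℕ) : PF d (Fin 2) →ₗ[ℂ] PF d ℕ := relabel (pairIndex k)

/-! ### Four-string braids -/

/-- `ζ` is a square root of `q = exp (2 π i / d)` with `ζ ^ (d ^ 2) = 1`. -/
def IsTwistRoot (d : ℕ) (ζ : ℂ) : Prop :=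
  ζ ^ 2 = Complex.exp (2 * Real.pi * Complex.I / d) ∧ ζ ^ (d ^ 2) = 1

/-- The phase `ω = d ^ (-1/2) * ∑ j < d, ζ ^ (j ^ 2)`. -/
noncomputable def gaussPhase (d : ℕ) (ζ : ℂ) : ℂ :=
  (Real.sqrt d : ℂ)⁻¹ * ∑ j ∈ Finset.range d, ζ ^ (j ^ 2)

section Braid

variable [NeZero d]

theorem sum_range_zmod {M : Type*} [AddCommMonoid M] (f : ZMod d → M) :
    ∑ i ∈ Finset.range d, f (i : ZMod d) = ∑ i : ZMod d, f i := by
  refine Finset.sum_bij' (fun i _ => (i : ZMod d)) (fun x _ => x.val) ?_ ?_ ?_ ?_ ?_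
  · simp
  · intro x _
    simpa using ZMod.val_lt x
  · intro i hi
    exact ZMod.val_cast_of_lt (Finset.mem_range.mp hi)
  · intro x _
    simp
  · intro i _
    rfl

theorem sum_stdAddChar_mul (s : ZMod d) :
    ∑ l : ZMod d, (ZMod.stdAddChar (l * s) : ℂ) = if s = 0 then (d : ℂ) else 0 := by
  have h := AddChar.sum_mulShift s (ZMod.isPrimitive_stdAddChar d)
  simpa [ZMod.card] using h

/-- The phase `ω` has modulus one. -/
theorem gaussPhase_norm {ζ : ℂ} (hζ : IsTwistRoot d ζ) : ‖gaussPhase d ζ‖ = 1 := by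
  obtain ⟨h2, hd⟩ := hζ
  have hq (n : ℕ) : (ZMod.stdAddChar (n : ZMod d) : ℂ) = ζ ^ (2 * n) := by
    rw [pow_mul, h2, ← Complex.exp_nat_mul]
    have := ZMod.stdAddChar_coe (N := d) n
    push_cast at this
    rw [this]
    congr 1
    ring
  have hnorm : ‖ζ‖ = 1 := by
    refine Complex.norm_eq_one_of_pow_eq_one hd ?_
    exact pow_ne_zero 2 (NeZero.ne d)
  have hz : ζ ≠ 0 := by
    intro h
    simp [h] at hnorm
  have hmod (n m : ℕ) : ζ ^ ((n + d * m) ^ 2) = ζ ^ (n ^ 2) := by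
    have e : (n + d * m) ^ 2 = n ^ 2 + 2 * (n * (d * m)) + d ^ 2 * m ^ 2 := by ring
    rw [e, pow_add, pow_add, pow_mul ζ (d ^ 2), hd, one_pow, mul_one, ← hq]
    simp
  have hval (n : ℕ) : ζ ^ ((n : ZMod d).val ^ 2) = ζ ^ (n ^ 2) := by
    rw [ZMod.val_natCast, ← hmod (n % d) (n / d), Nat.mod_add_div]
  let g : ZMod d → ℂ := fun x => ζ ^ (x.val ^ 2)
  have hg (x y : ZMod d) : g (x + y) = g x * g y * ZMod.stdAddChar (x * y) := by
    have hxy : x + y = ((x.val + y.val : ℕ) : ZMod d) := by simp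
    have hxy' : x * y = ((x.val * y.val : ℕ) : ZMod d) := by simp
    simp only [g]
    rw [hxy', hq, hxy, hval]
    ring
  have hgn (x : ZMod d) : g x * star (g x) = 1 := by
    change g x * (starRingEnd ℂ) (g x) = 1
    rw [Complex.mul_conj, Complex.normSq_eq_norm_sq]
    simp [g, hnorm]
  have hsum : ∑ j ∈ Finset.range d, ζ ^ (j ^ 2) = ∑ x : ZMod d, g x := by
    rw [← sum_range_zmod]
    refine Finset.sum_congr rfl fun j _ => ?_
    exact (hval j).symm
  have hgg : (∑ x : ZMod d, g x) * star (∑ x : ZMod d, g x) = d := by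
    rw [star_sum, Finset.sum_mul_sum, Finset.sum_comm]
    have h1 (l : ZMod d) : ∑ x : ZMod d, g x * star (g l)
        = ∑ s : ZMod d, g s * ZMod.stdAddChar (l * s) := by
      rw [← Equiv.sum_comp (Equiv.addLeft l)]
      refine Finset.sum_congr rfl fun s _ => ?_
      simp only [Equiv.coe_addLeft, hg]
      linear_combination (g s * ZMod.stdAddChar (l * s)) * hgn l
    simp_rw [h1]
    rw [Finset.sum_comm]
    simp_rw [← Finset.mul_sum, sum_stdAddChar_mul]
    simp [g]
  have hn : ‖∑ x : ZMod d, g x‖ ^ 2 = d := by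
    have h3 : (∑ x : ZMod d, g x) * (starRingEnd ℂ) (∑ x : ZMod d, g x) = d := hgg
    rw [Complex.mul_conj, Complex.normSq_eq_norm_sq] at h3
    exact_mod_cast h3
  have hd0 : (0 : ℝ) < d := by exact_mod_cast Nat.pos_of_ne_zero (NeZero.ne d)
  rw [gaussPhase, hsum, norm_mul, norm_inv, Complex.norm_real, Real.norm_of_nonneg (Real.sqrt_nonneg _),
    ← hn, Real.sqrt_sq (norm_nonneg _)]
  refine inv_mul_cancel₀ ?_
  intro h
  rw [h] at hn
  norm_num at hn
  exact hd0.ne hn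

/-- The two-string braid `b_k = (ω ^ (1/2) / √d) ∑ i < d, c k ^ i * c (k + 1) ^ (-i)`. -/
noncomputable def twoStringBraid (ζ : ℂ) (k : ℕ) : PF d ℕ :=
  (gaussPhase d ζ ^ (1 / 2 : ℂ) / (Real.sqrt d : ℂ)) •
    ∑ i ∈ Finset.range d, c k ^ i * star (c (k + 1)) ^ i

theorem twoStringBraid_mem_unitary {ζ : ℂ} (hζ : IsTwistRoot d ζ) (k : ℕ) :
    twoStringBraid ζ k ∈ unitary (PF d ℕ) := by
  let e : ZMod d → (ℕ →₀ ZMod d) := fun i => Finsupp.single k i + -Finsupp.single (k + 1) i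
  have hadd (i l : ZMod d) : e i + -e l = e (i - l) := by
    simp only [e, sub_eq_add_neg, Finsupp.single_add, Finsupp.single_neg]
    abel
  have hre (i l : ZMod d) : reorderExponent (e i) (e l) = i * l := by
    simp only [e, reorderExponent_add_left, reorderExponent_add_right, reorderExponent_neg_left,
      reorderExponent_neg_right, reorderExponent_single]
    simp
  have hsum : ∑ i ∈ Finset.range d, c k ^ i * star (c (k + 1)) ^ i
      = ∑ i : ZMod d, (monomial (e i) 1 : PF d ℕ) := by
    rw [← sum_range_zmod]
    refine Finset.sum_congr rfl fun i _ => ?_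
    rw [← star_pow, c_pow, c_pow, star_monomial, monomial_mul_monomial, reorderExponent_neg_right,
      reorderExponent_single, reorderExponent_single]
    simp [e]
  have hone : (∑ s : ZMod d, monomial (e s) (if s = 0 then (d : ℂ) else 0)) = (d : ℂ) • (1 : PF d ℕ) := by
    rw [Finset.sum_eq_single 0]
    · simp [e, one_def, smul_monomial]
    · intro s _ hs
      simp [hs, monomial_zero]
    · simp
  have hms (m : ℕ →₀ ZMod d) (f : ZMod d → ℂ) :
      ∑ l : ZMod d, (monomial m (f l) : PF d ℕ) = monomial m (∑ l : ZMod d, f l) :=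
    (map_sum (Finsupp.singleAddHom m) f Finset.univ).symm
  have hprod (s l : ZMod d) : (monomial (e (s + l)) 1 : PF d ℕ) * star (monomial (e l) 1)
      = monomial (e s) (ZMod.stdAddChar (l * -s)) := by
    rw [star_monomial, monomial_mul_monomial, hadd, reorderExponent_neg_right, hre, hre]
    simp only [star_one, one_mul, ← AddChar.map_add_eq_mul]
    congr 2
    · ring
    · ring
  have hprod' (s l : ZMod d) : star (monomial (e l) 1) * (monomial (e (s + l)) 1 : PF d ℕ)
      = monomial (e s) (ZMod.stdAddChar (l * -s)) := by
    rw [star_monomial, monomial_mul_monomial, add_comm (-e l), hadd, reorderExponent_neg_left, hre,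
      hre]
    simp only [star_one, one_mul, mul_one, ← AddChar.map_add_eq_mul]
    congr 2
    · ring
    · ring
  have hA : (∑ i : ZMod d, (monomial (e i) 1 : PF d ℕ)) * star (∑ i : ZMod d, monomial (e i) 1)
      = (d : ℂ) • 1 := by
    rw [star_sum, Finset.sum_mul_sum, Finset.sum_comm]
    have h1 (l : ZMod d) : ∑ i : ZMod d, (monomial (e i) 1 : PF d ℕ) * star (monomial (e l) 1)
        = ∑ s : ZMod d, monomial (e s) (ZMod.stdAddChar (l * -s)) := by
      rw [← Equiv.sum_comp (Equiv.addRight l)]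
      exact Finset.sum_congr rfl fun s _ => hprod s l
    simp_rw [h1]
    rw [Finset.sum_comm]
    simp_rw [hms, sum_stdAddChar_mul, neg_eq_zero]
    exact hone
  have hB : star (∑ i : ZMod d, monomial (e i) 1) * (∑ i : ZMod d, (monomial (e i) 1 : PF d ℕ))
      = (d : ℂ) • 1 := by
    rw [star_sum, Finset.sum_mul_sum]
    have h1 (l : ZMod d) : ∑ i : ZMod d, star (monomial (e l) 1) * (monomial (e i) 1 : PF d ℕ)
        = ∑ s : ZMod d, monomial (e s) (ZMod.stdAddChar (l * -s)) := by
      rw [← Equiv.sum_comp (Equiv.addRight l)]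
      exact Finset.sum_congr rfl fun s _ => hprod' s l
    simp_rw [h1]
    rw [Finset.sum_comm]
    simp_rw [hms, sum_stdAddChar_mul, neg_eq_zero]
    exact hone
  have hcoef : star (gaussPhase d ζ ^ (1 / 2 : ℂ) / (Real.sqrt d : ℂ)) *
      (gaussPhase d ζ ^ (1 / 2 : ℂ) / (Real.sqrt d : ℂ)) * d = 1 := by
    have hd0 : (0 : ℝ) < d := by exact_mod_cast Nat.pos_of_ne_zero (NeZero.ne d)
    have hw : ‖gaussPhase d ζ ^ (1 / 2 : ℂ)‖ = 1 := by
      have h := Complex.norm_cpow_real (gaussPhase d ζ) (1 / 2)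
      rw [gaussPhase_norm hζ, Real.one_rpow] at h
      simpa using h
    change (starRingEnd ℂ) _ * _ * _ = _
    rw [mul_comm ((starRingEnd ℂ) _), Complex.mul_conj, Complex.normSq_eq_norm_sq, norm_div, hw,
      Complex.norm_real, Real.norm_of_nonneg (Real.sqrt_nonneg _), div_pow, Real.sq_sqrt hd0.le]
    rw [one_pow]
    push_cast
    exact one_div_mul_cancel (by exact_mod_cast hd0.ne')
  rw [Unitary.mem_iff]
  simp only [twoStringBraid, hsum]
  rw [star_smul, smul_mul_smul_comm, smul_mul_smul_comm, hA, hB, smul_smul, smul_smul, hcoef,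
    mul_comm (gaussPhase d ζ ^ (1 / 2 : ℂ) / (Real.sqrt d : ℂ)), hcoef]
  simp

/-- The four-string braid `b_j`, which braids the `j`-th pair of strings `2 j`, `2 j + 1` with the
next pair `2 j + 2`, `2 j + 3`. -/
noncomputable def fourStringBraid {ζ : ℂ} (hζ : IsTwistRoot d ζ) (j : ℕ) : unitary (PF d ℕ) :=
  let b : ℕ → unitary (PF d ℕ) := fun k => ⟨twoStringBraid ζ k, twoStringBraid_mem_unitary hζ k⟩
  b (2 * j + 1) * (b (2 * j) * b (2 * j + 2)) * b (2 * j + 1)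

/-- The braid group `𝔹_∞`, generated by the four-string braids in the unitary group of `PF_∞`. -/
noncomputable def braidGroup {ζ : ℂ} (hζ : IsTwistRoot d ζ) : Subgroup (unitary (PF d ℕ)) :=
  Subgroup.closure (Set.range (fourStringBraid hζ))

/-- Invariance of a functional on `PF_∞` under the adjoint action of the braid group. -/
def IsBraidInvariant {ζ : ℂ} (hζ : IsTwistRoot d ζ) (φ : PF d ℕ →ₗ[ℂ] ℂ) : Prop :=
  ∀ b ∈ braidGroup hζ, ∀ x : PF d ℕ, φ ((b : PF d ℕ) * x * ((b⁻¹ : unitary (PF d ℕ)) : PF d ℕ)) = φ x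

end Braid

/-! ### States -/

/-- A state: a positive, normalised linear functional. -/
def IsState [LinearOrder ι] [NeZero d] (φ : PF d ι →ₗ[ℂ] ℂ) : Prop :=
  φ 1 = 1 ∧ ∀ x : PF d ι, 0 ≤ φ (star x * x)

/-- A neutral functional vanishes on all elements of non-zero charge. -/
def IsNeutral (φ : PF d ι →ₗ[ℂ] ℂ) : Prop :=
  ∀ k : ZMod d, k ≠ 0 → ∀ x ∈ chargePart d ι k, φ x = 0

/-- `ψ` is the infinite product of copies of `ρ`: it is multiplicative on products, in increasing
order, of elements of the different pairs. -/
def IsInfiniteProduct [NeZero d] (ρ : PF d (Fin 2) →ₗ[ℂ] ℂ) (ψ : PF d ℕ →ₗ[ℂ] ℂ) : Prop :=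
  ∀ (n : ℕ) (x : Fin n → PF d (Fin 2)),
    ψ (List.ofFn fun k : Fin n => pairEmbedding (k : ℕ) (x k)).prod = ∏ k : Fin n, ρ (x k)

/-- The product states `ρ ^ ⊗∞` on `PF_∞` with `ρ` a neutral state on `PF_2`, as functions on
`PF_∞`. -/
def neutralProductStates (d : ℕ) [NeZero d] : Set (PF d ℕ → ℂ) :=
  {f | ∃ ρ : PF d (Fin 2) →ₗ[ℂ] ℂ, IsState ρ ∧ IsNeutral ρ ∧
    ∃ ψ : PF d ℕ →ₗ[ℂ] ℂ, IsState ψ ∧ IsInfiniteProduct ρ ψ ∧ f = ψ}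

end PF

/-! Write the product of the braids on strings `2p+1`, `2p`, `2p+2`, `2p+1` as `b`. Conjugation by
`b` carries `c (2p+2)`, `c (2p+3)` to `c (2p)`, `c (2p+1)`, so it moves any monomial of the pair `p
+ 1` down to the pair `p`. The opposite move, from `p` up to `p + 1`, is available for neutral
monomials `c ^ a * c' ^ (-a)`. An invariant state therefore does not notice the exchange of a
neutral pair with an arbitrary neighbouring pair (`IsBraidInvariant.apply_swap`), and no phase
appears.

Neutrality. Let `w i` be a monomial of charge `s ≠ 0` placed in the pair `i`. An empty pair is
neutral, so `φ (star (w i) * w j)` is the same number `γ` for all `i < j`. Cauchy-Schwarz on long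
blocks forces a constant correlation to be real and non-negative. The same holds for the sequence
`star (w i)`, whose correlation is the conjugate of `q ^ (s ^ 2) * γ`. For squarefree `d` the ring
`ZMod d` is reduced, so `q ^ (s ^ 2) ≠ 1` and `γ = 0`. The `w i` are then orthonormal, and a vector
with constant inner product against all of them has inner product zero. After moving the last
charged pair to the right end of a monomial, this shows that `φ` kills every monomial with a charged
pair (`apply_eq_zero_of_charged`).

De Finetti. What remains is the algebra spanned by products of neutral pairs. It is commutative, and
after rescaling by `ζ ^ (x ^ 2)` its monomials represent `ZMod d ^ n`. A state restricted to it is a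
probability distribution on characters `t : Fin n → ZMod d`, and braid invariance makes that
distribution exchangeable. Replacing each `t` by the product state of its empirical measure gives a
finite mixture of neutral product states. On a monomial in `r` pairs the mixture averages over all
maps `Fin r → Fin n`, while `φ` is recovered from the injective ones; the difference tends to zero
as `n` grows. -/

namespace PF

/-! ### Products and adjoints of monomials -/

section Monomials

variable {d : ℕ} {ι : Type} [LinearOrder ι]

theorem reorderExponent_eq_zero {m n : ι →₀ ZMod d}
    (h : ∀ j k, m k ≠ 0 → n j ≠ 0 → k ≤ j) : reorderExponent m n = 0 := by
  unfold reorderExponent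
  rw [neg_eq_zero]
  refine Finset.sum_eq_zero fun k hk => Finset.sum_eq_zero fun j hj => ?_
  exact if_neg (h j k (Finsupp.mem_support_iff.mp hk) (Finsupp.mem_support_iff.mp hj)).not_gt

variable [NeZero d]

theorem mon_mul_mon (m n : ι →₀ ZMod d) :
    (monomial m 1 * monomial n 1 : PF d ι) =
      (ZMod.stdAddChar (reorderExponent m n) : ℂ) • monomial (m + n) 1 := by
  simp [monomial_mul_monomial, smul_monomial]

theorem star_mon (m : ι →₀ ZMod d) :
    star (monomial m 1 : PF d ι) =
      (ZMod.stdAddChar (reorderExponent m m) : ℂ) • monomial (-m) 1 := by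
  simp [star_monomial, smul_monomial]

theorem monomial_eq_smul (m : ι →₀ ZMod d) (a : ℂ) :
    (monomial m a : PF d ι) = a • monomial m 1 := by
  simp [smul_monomial]

theorem mon_mul_mon_of_le {m n : ι →₀ ZMod d} (h : ∀ j k, m k ≠ 0 → n j ≠ 0 → k ≤ j) :
    (monomial m 1 * monomial n 1 : PF d ι) = monomial (m + n) 1 := by
  rw [mon_mul_mon, reorderExponent_eq_zero h]
  simp

theorem mon_single_eq_pow (j : ι) (a : ZMod d) :
    (monomial (Finsupp.single j a) 1 : PF d ι) = c j ^ a.val := by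
  rw [c_pow, ZMod.natCast_zmod_val]

theorem stdAddChar_ne_zero (a : ZMod d) : (ZMod.stdAddChar a : ℂ) ≠ 0 := by
  intro h
  have h2 : (ZMod.stdAddChar (a + -a) : ℂ) = 1 := by simp
  rw [AddChar.map_add_eq_mul, h, zero_mul] at h2
  exact zero_ne_one h2

theorem norm_stdAddChar (a : ZMod d) : ‖(ZMod.stdAddChar a : ℂ)‖ = 1 :=
  AddChar.norm_apply _ a

end Monomials

/-! ### Neutral monomials on two adjacent strings, and two-string braids -/

section NeutralPairs

variable {d : ℕ}

/-- The exponent of `c k ^ a * c (k + 1) ^ (-a)`. -/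
noncomputable def adjacentExponent (k : ℕ) (a : ZMod d) : ℕ →₀ ZMod d :=
  Finsupp.single k a + -Finsupp.single (k + 1) a

/-- A string other than `k + 1` lies above both of `k`, `k + 1` or above neither, so the
contributions of `a` and `-a` cancel; only string `k + 1` separates them. -/
theorem reorderExponent_adjacent_right (m : ℕ →₀ ZMod d) (k : ℕ) (a : ZMod d) :
    reorderExponent m (adjacentExponent k a) = -(m (k + 1) * a) := by
  induction m using Finsupp.induction_linear with
  | zero => simp [reorderExponent_zero_left]
  | add f g hf hg =>
    rw [reorderExponent_add_left, hf, hg, Finsupp.add_apply]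
    ring
  | single j b =>
    rw [adjacentExponent, reorderExponent_add_right, reorderExponent_neg_right,
      reorderExponent_single, reorderExponent_single, Finsupp.single_apply]
    rcases lt_trichotomy j (k + 1) with h | h | h
    · have h1 : ¬ k < j := by omega
      have h2 : ¬ k + 1 < j := by omega
      simp [h1, h2, h.ne]
    · subst h
      simp
    · have h1 : k < j := by omega
      simp [h1, h, h.ne']

theorem reorderExponent_adjacent_left (m : ℕ →₀ ZMod d) (k : ℕ) (a : ZMod d) :
    reorderExponent (adjacentExponent k a) m = a * m k := by
  induction m using Finsupp.induction_linear with
  | zero => simp [reorderExponent_zero_right]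
  | add f g hf hg =>
    rw [reorderExponent_add_right, hf, hg, Finsupp.add_apply]
    ring
  | single j b =>
    rw [adjacentExponent, reorderExponent_add_left, reorderExponent_neg_left,
      reorderExponent_single, reorderExponent_single, Finsupp.single_apply]
    rcases lt_trichotomy j k with h | h | h
    · have h1 : j < k + 1 := by omega
      simp [h1, h, h.ne]
    · subst h
      simp
    · have h1 : ¬ j < k := by omega
      have h2 : ¬ j < k + 1 := by omega
      simp [h1, h2, h.ne']

/-- The exponent of `c (2 * p) ^ x * c (2 * p + 1) ^ y`. -/
noncomputable def pairExponent (p : ℕ) (x y : ZMod d) : ℕ →₀ ZMod d :=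
  Finsupp.single (2 * p) x + Finsupp.single (2 * p + 1) y

theorem pairExponent_neg_right (p : ℕ) (a : ZMod d) :
    pairExponent p a (-a) = adjacentExponent (2 * p) a := by
  simp [pairExponent, adjacentExponent]

theorem pairExponent_apply (p : ℕ) (x y : ZMod d) (j : ℕ) :
    pairExponent p x y j = (if j = 2 * p then x else 0) + (if j = 2 * p + 1 then y else 0) := by
  simp [pairExponent, Finsupp.single_apply, eq_comm]

theorem pairExponent_apply_of_ne {p j : ℕ} (x y : ZMod d) (h1 : j ≠ 2 * p) (h2 : j ≠ 2 * p + 1) :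
    pairExponent p x y j = 0 := by
  simp [pairExponent_apply, h1, h2]

theorem eq_or_eq_of_pairExponent_ne_zero {p j : ℕ} {x y : ZMod d} (h : pairExponent p x y j ≠ 0) :
    j = 2 * p ∨ j = 2 * p + 1 := by
  by_contra! h'
  exact h (pairExponent_apply_of_ne x y h'.1 h'.2)

theorem pairExponent_apply_even (p : ℕ) (x y : ZMod d) : pairExponent p x y (2 * p) = x := by
  simp [pairExponent_apply]

theorem pairExponent_apply_odd (p : ℕ) (x y : ZMod d) : pairExponent p x y (2 * p + 1) = y := by
  simp [pairExponent_apply]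

theorem pairExponent_zero (p : ℕ) : pairExponent p (0 : ZMod d) 0 = 0 := by
  simp [pairExponent]

theorem neg_pairExponent (p : ℕ) (x y : ZMod d) :
    -pairExponent p x y = pairExponent p (-x) (-y) := by
  simp [pairExponent]
  abel

variable [NeZero d]

theorem commute_mon_adjacent (m : ℕ →₀ ZMod d) (k : ℕ) (a : ZMod d) (h : m k + m (k + 1) = 0) :
    Commute (monomial (adjacentExponent k a) 1 : PF d ℕ) (monomial m 1) := by
  unfold Commute SemiconjBy
  rw [mon_mul_mon, mon_mul_mon, reorderExponent_adjacent_left, reorderExponent_adjacent_right,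
    add_comm m, eq_neg_of_add_eq_zero_left h]
  congr 3
  ring

theorem twoStringBraid_eq (ζ : ℂ) (k : ℕ) :
    (twoStringBraid ζ k : PF d ℕ) = (gaussPhase d ζ ^ (1 / 2 : ℂ) / (Real.sqrt d : ℂ)) •
      ∑ i : ZMod d, monomial (adjacentExponent k i) 1 := by
  rw [twoStringBraid, ← sum_range_zmod]
  congr 1
  refine Finset.sum_congr rfl fun j _ => ?_
  rw [← star_pow, c_pow, c_pow, star_monomial, monomial_mul_monomial, reorderExponent_neg_right,
    reorderExponent_single, reorderExponent_single]
  simp [adjacentExponent]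

theorem commute_twoStringBraid_mon (ζ : ℂ) (m : ℕ →₀ ZMod d) (k : ℕ) (h : m k + m (k + 1) = 0) :
    Commute (twoStringBraid ζ k : PF d ℕ) (monomial m 1) := by
  rw [twoStringBraid_eq]
  refine Commute.smul_left (Commute.sum_left _ _ _ fun i _ => ?_) _
  exact commute_mon_adjacent m k i h

/-- Up to a scalar the braid is the sum of all `c k ^ i * c (k + 1) ^ (-i)`, and the relation is the
shift `i ↦ i + 1` of the summation index. -/
theorem semiconjBy_twoStringBraid_c (ζ : ℂ) (k : ℕ) :
    SemiconjBy (twoStringBraid ζ k : PF d ℕ) (c (k + 1)) (c k) := by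
  unfold SemiconjBy
  rw [twoStringBraid_eq, smul_mul_assoc, mul_smul_comm, Finset.sum_mul, Finset.mul_sum]
  congr 1
  rw [← Equiv.sum_comp (Equiv.addRight (1 : ZMod d))]
  refine Finset.sum_congr rfl fun i _ => ?_
  simp only [c, mon_mul_mon, reorderExponent_adjacent_left, reorderExponent_adjacent_right]
  simp [adjacentExponent]
  congr 1
  abel

end NeutralPairs

/-! ### Conjugation of generators by the braids -/

section Braids

variable {d : ℕ} [NeZero d]

/-- The generators as elements of the unitary group. -/
noncomputable def unitaryC (j : ℕ) : unitary (PF d ℕ) := ⟨c j, c_mem_unitary j⟩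

/-- The two-string braids as elements of the unitary group. -/
noncomputable def unitaryBraid {ζ : ℂ} (hζ : IsTwistRoot d ζ) (k : ℕ) : unitary (PF d ℕ) :=
  ⟨twoStringBraid ζ k, twoStringBraid_mem_unitary hζ k⟩

theorem semiconjBy_unitary_iff {b x y : unitary (PF d ℕ)} :
    SemiconjBy b x y ↔ SemiconjBy (b : PF d ℕ) x y := by
  simp [SemiconjBy, Subtype.ext_iff]

variable {ζ : ℂ} (hζ : IsTwistRoot d ζ)

theorem semiconjBy_unitaryBraid (k : ℕ) :
    SemiconjBy (unitaryBraid hζ k) (unitaryC (k + 1)) (unitaryC k) :=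
  semiconjBy_unitary_iff.mpr (semiconjBy_twoStringBraid_c ζ k)

theorem commute_unitaryBraid {k j : ℕ} (h1 : j ≠ k) (h2 : j ≠ k + 1) :
    SemiconjBy (unitaryBraid hζ k) (unitaryC j) (unitaryC j) := by
  refine semiconjBy_unitary_iff.mpr (commute_twoStringBraid_mon ζ _ k ?_)
  simp [h1, h2]

theorem coe_unitaryC_mul_inv (k : ℕ) :
    ((unitaryC k * (unitaryC (k + 1))⁻¹ : unitary (PF d ℕ)) : PF d ℕ) =
      monomial (adjacentExponent k 1) 1 := by
  change c k * star (c (k + 1)) = _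
  rw [c, c, star_mon, mul_smul_comm, mon_mul_mon, reorderExponent_neg_right,
    reorderExponent_single, reorderExponent_single]
  simp [adjacentExponent]

/-- Factor `c k` as `(c k * (c (k + 1))⁻¹) * c (k + 1)`: the braid commutes with the first factor
and turns the second into `c k`. -/
theorem semiconjBy_unitaryBraid' (k : ℕ) : SemiconjBy (unitaryBraid hζ k) (unitaryC k)
    (unitaryC k * (unitaryC (k + 1))⁻¹ * unitaryC k) := by
  have h : SemiconjBy (unitaryBraid hζ k) (unitaryC k * (unitaryC (k + 1))⁻¹)
      (unitaryC k * (unitaryC (k + 1))⁻¹) := by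
    rw [semiconjBy_unitary_iff, coe_unitaryC_mul_inv]
    refine commute_twoStringBraid_mon ζ _ k ?_
    simp [adjacentExponent]
  simpa using h.mul_right (semiconjBy_unitaryBraid hζ k)

theorem commute_neutral (j k : ℕ) (h : j + 2 ≤ k) :
    Commute (unitaryC j * (unitaryC (j + 1))⁻¹ : unitary (PF d ℕ))
      (unitaryC k * (unitaryC (k + 1))⁻¹) := by
  refine semiconjBy_unitary_iff.mpr ?_
  rw [coe_unitaryC_mul_inv, coe_unitaryC_mul_inv]
  refine commute_mon_adjacent _ _ _ ?_
  have h1 : k ≠ j := by omega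
  have h2 : k + 1 ≠ j := by omega
  have h3 : k ≠ j + 1 := by omega
  have h4 : k + 1 ≠ j + 1 := by omega
  simp [adjacentExponent, *]

theorem semiconjBy_fourStringBraid_even (p : ℕ) :
    SemiconjBy (fourStringBraid hζ p) (unitaryC (2 * p + 2)) (unitaryC (2 * p)) := by
  have s1 := semiconjBy_unitaryBraid hζ (2 * p + 1)
  have s2 := commute_unitaryBraid hζ (k := 2 * p + 2) (j := 2 * p + 1) (by omega) (by omega)
  have s3 := semiconjBy_unitaryBraid hζ (2 * p)
  have s4 := commute_unitaryBraid hζ (k := 2 * p + 1) (j := 2 * p) (by omega) (by omega)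
  exact (s4.mul_left (s3.mul_left s2)).mul_left s1

theorem semiconjBy_fourStringBraid_odd (p : ℕ) :
    SemiconjBy (fourStringBraid hζ p) (unitaryC (2 * p + 3)) (unitaryC (2 * p + 1)) := by
  have s1 := commute_unitaryBraid hζ (k := 2 * p + 1) (j := 2 * p + 3) (by omega) (by omega)
  have s2 := semiconjBy_unitaryBraid hζ (2 * p + 2)
  have s3 := commute_unitaryBraid hζ (k := 2 * p) (j := 2 * p + 2) (by omega) (by omega)
  have s4 := semiconjBy_unitaryBraid hζ (2 * p + 1)
  exact (s4.mul_left (s3.mul_left s2)).mul_left s1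

theorem semiconjBy_fourStringBraid_neutral (p : ℕ) :
    SemiconjBy (fourStringBraid hζ p) (unitaryC (2 * p) * (unitaryC (2 * p + 1))⁻¹)
      (unitaryC (2 * p + 2) * (unitaryC (2 * p + 3))⁻¹) := by
  set x : unitary (PF d ℕ) := unitaryC (2 * p) with hx
  set y : unitary (PF d ℕ) := unitaryC (2 * p + 1) with hy
  set z : unitary (PF d ℕ) := unitaryC (2 * p + 2) with hz
  set w : unitary (PF d ℕ) := unitaryC (2 * p + 3) with hw
  -- The prefixes `b1`, `b2`, `b3` refer to the braids on strings `2p`, `2p+1`, `2p+2`; the four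
  -- factors are applied in turn to the word `x * y⁻¹`.
  have b2x : SemiconjBy (unitaryBraid hζ (2 * p + 1)) x x :=
    commute_unitaryBraid hζ (by omega) (by omega)
  have b2y : SemiconjBy (unitaryBraid hζ (2 * p + 1)) y (y * z⁻¹ * y) :=
    semiconjBy_unitaryBraid' hζ _
  have b2z : SemiconjBy (unitaryBraid hζ (2 * p + 1)) z y := semiconjBy_unitaryBraid hζ _
  have b2w : SemiconjBy (unitaryBraid hζ (2 * p + 1)) w w :=
    commute_unitaryBraid hζ (by omega) (by omega)
  have b3x : SemiconjBy (unitaryBraid hζ (2 * p + 2)) x x :=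
    commute_unitaryBraid hζ (by omega) (by omega)
  have b3y : SemiconjBy (unitaryBraid hζ (2 * p + 2)) y y :=
    commute_unitaryBraid hζ (by omega) (by omega)
  have b3z : SemiconjBy (unitaryBraid hζ (2 * p + 2)) z (z * w⁻¹ * z) :=
    semiconjBy_unitaryBraid' hζ _
  have b1x : SemiconjBy (unitaryBraid hζ (2 * p)) x (x * y⁻¹ * x) :=
    semiconjBy_unitaryBraid' hζ _
  have b1y : SemiconjBy (unitaryBraid hζ (2 * p)) y x := semiconjBy_unitaryBraid hζ _
  have b1z : SemiconjBy (unitaryBraid hζ (2 * p)) z z :=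
    commute_unitaryBraid hζ (by omega) (by omega)
  have b1w : SemiconjBy (unitaryBraid hζ (2 * p)) w w :=
    commute_unitaryBraid hζ (by omega) (by omega)
  have s1 : SemiconjBy (unitaryBraid hζ (2 * p + 1)) (x * y⁻¹) (x * (y * z⁻¹ * y)⁻¹) :=
    b2x.mul_right b2y.inv_right
  have s2 := b3x.mul_right ((b3y.mul_right b3z.inv_right).mul_right b3y).inv_right
  have s3 := b1x.mul_right ((b1y.mul_right
    ((b1z.mul_right b1w.inv_right).mul_right b1z).inv_right).mul_right b1y).inv_right
  have s4 := ((b2x.mul_right b2y.inv_right).mul_right b2x).mul_right ((b2x.mul_right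
    ((b2z.mul_right b2w.inv_right).mul_right b2z).inv_right).mul_right b2x).inv_right
  have s := (s4.mul_left (s3.mul_left s2)).mul_left s1
  have hc := commute_neutral (d := d) (2 * p) (2 * p + 2) (by omega)
  change Commute (x * y⁻¹) (z * w⁻¹) at hc
  -- The resulting word is a conjugate of `z * w⁻¹` by `x * y⁻¹`, and neutral elements of disjoint
  -- pairs commute.
  have e : x * (y * z⁻¹ * y)⁻¹ * x * (x * (y * w⁻¹ * y)⁻¹ * x)⁻¹ = z * w⁻¹ := by
    calc _ = (x * y⁻¹) * (z * w⁻¹) * (x * y⁻¹)⁻¹ := by group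
      _ = z * w⁻¹ := by rw [hc.eq, mul_inv_cancel_right]
  rw [e] at s
  exact s

end Braids

/-! ### Exchange of a neutral pair with an arbitrary pair -/

section BraidAction

variable {d : ℕ}

/-- An exponent which is trivial on the pairs `p` and `p + 1`. -/
def VanishesAt (m : ℕ →₀ ZMod d) (p : ℕ) : Prop :=
  m (2 * p) = 0 ∧ m (2 * p + 1) = 0 ∧ m (2 * p + 2) = 0 ∧ m (2 * p + 3) = 0

theorem reorderExponent_single_succ (m : ℕ →₀ ZMod d) (k : ℕ) (a : ZMod d) (h : m (k + 1) = 0) :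
    reorderExponent m (Finsupp.single (k + 1) a) = reorderExponent m (Finsupp.single k a) := by
  have h1 := reorderExponent_adjacent_right m k a
  rw [adjacentExponent, reorderExponent_add_right, reorderExponent_neg_right, h, zero_mul,
    neg_zero, add_neg_eq_zero] at h1
  exact h1.symm

theorem reorderExponent_pair_succ {m : ℕ →₀ ZMod d} {p : ℕ} (h : VanishesAt m p) (x y : ZMod d) :
    reorderExponent m (pairExponent (p + 1) x y) = reorderExponent m (pairExponent p x y) := by
  obtain ⟨-, h1, h2, h3⟩ := h
  have e3 := reorderExponent_single_succ m (2 * p + 2) y h3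
  have e2 (z : ZMod d) := reorderExponent_single_succ m (2 * p + 1) z h2
  have e1 := reorderExponent_single_succ m (2 * p) x h1
  simp only [pairExponent, reorderExponent_add_right, mul_add, mul_one, add_assoc,
    Nat.reduceAdd] at *
  rw [e3, e2, e2, e1]

/-- An exponent with the entries of the pairs `p` and `p + 1` removed. -/
theorem exists_erase_pairs (m : ℕ →₀ ZMod d) (p : ℕ) :
    ∃ m₀ : ℕ →₀ ZMod d, VanishesAt m₀ p ∧
      (∀ j, j < 2 * p ∨ 2 * p + 4 ≤ j → m₀ j = m j) ∧
      m = m₀ + pairExponent p (m (2 * p)) (m (2 * p + 1)) +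
        pairExponent (p + 1) (m (2 * p + 2)) (m (2 * p + 3)) := by
  refine ⟨m - (pairExponent p (m (2 * p)) (m (2 * p + 1)) +
        pairExponent (p + 1) (m (2 * p + 2)) (m (2 * p + 3))), ?_, ?_, by abel⟩
  · refine ⟨?_, ?_, ?_, ?_⟩ <;>
    · simp only [Finsupp.sub_apply, Finsupp.add_apply, pairExponent_apply]
      simp [mul_add]
      try omega
  · intro j hj
    rw [Finsupp.sub_apply, Finsupp.add_apply, pairExponent_apply_of_ne _ _ (by omega) (by omega),
      pairExponent_apply_of_ne _ _ (by omega) (by omega)]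
    simp

theorem reorderExponent_pair_pair {p r : ℕ} (h : p < r) (x y x' y' : ZMod d) :
    reorderExponent (pairExponent p x y) (pairExponent r x' y') = 0 := by
  refine reorderExponent_eq_zero fun j k hk hj => ?_
  have h1 := eq_or_eq_of_pairExponent_ne_zero hk
  have h2 := eq_or_eq_of_pairExponent_ne_zero hj
  omega

variable [NeZero d]

theorem mon_pair_mul (p : ℕ) (x y : ZMod d) :
    (monomial (pairExponent p x y) 1 : PF d ℕ) = c (2 * p) ^ x.val * c (2 * p + 1) ^ y.val := by
  rw [pairExponent, ← mon_single_eq_pow, ← mon_single_eq_pow, mon_mul_mon, reorderExponent_single]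
  simp

/-- The phase `θ` depends on `i` but not on `k`, so it cancels when the same power is compared on
two different pairs. -/
theorem exists_mon_adjacent_pow (i : ℕ) : ∃ θ : ℂ, θ ≠ 0 ∧ ∀ k : ℕ,
    (monomial (adjacentExponent k (1 : ZMod d)) 1 : PF d ℕ) ^ i =
      θ • monomial (adjacentExponent k (i : ZMod d)) 1 := by
  induction i with
  | zero => exact ⟨1, one_ne_zero, fun k => by simp [adjacentExponent, one_def]⟩
  | succ i ih =>
    obtain ⟨θ, hθ, h⟩ := ih
    refine ⟨θ * ZMod.stdAddChar (i : ZMod d), mul_ne_zero hθ (stdAddChar_ne_zero _), fun k => ?_⟩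
    rw [pow_succ, h, smul_mul_assoc, mon_mul_mon, smul_smul, reorderExponent_adjacent_left]
    congr 2
    · simp [adjacentExponent]
    · simp only [adjacentExponent, Nat.cast_add, Nat.cast_one, Finsupp.single_add]
      abel

variable {ζ : ℂ} (hζ : IsTwistRoot d ζ)

theorem commute_fourStringBraid_mon {m : ℕ →₀ ZMod d} {p : ℕ} (h : VanishesAt m p) :
    Commute (fourStringBraid hζ p : PF d ℕ) (monomial m 1) := by
  obtain ⟨h0, h1, h2, h3⟩ := h
  have c0 := commute_twoStringBraid_mon ζ m (2 * p) (by simp [h0, h1])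
  have c1 := commute_twoStringBraid_mon ζ m (2 * p + 1) (by simp [h1, h2])
  have c2 := commute_twoStringBraid_mon ζ m (2 * p + 2) (by simp [h2, h3])
  exact (c1.mul_left (c0.mul_left c2)).mul_left c1

theorem semiconjBy_fourStringBraid_pair (p : ℕ) (x y : ZMod d) :
    SemiconjBy (fourStringBraid hζ p : PF d ℕ) (monomial (pairExponent (p + 1) x y) 1)
      (monomial (pairExponent p x y) 1) := by
  rw [mon_pair_mul, mon_pair_mul]
  have h1 := semiconjBy_unitary_iff.mp (semiconjBy_fourStringBraid_even hζ p)
  have h2 := semiconjBy_unitary_iff.mp (semiconjBy_fourStringBraid_odd hζ p)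
  exact (h1.pow_right x.val).mul_right (h2.pow_right y.val)

theorem semiconjBy_fourStringBraid_neutralPair (p : ℕ) (a : ZMod d) :
    SemiconjBy (fourStringBraid hζ p : PF d ℕ) (monomial (pairExponent p a (-a)) 1)
      (monomial (pairExponent (p + 1) a (-a)) 1) := by
  have h1 := semiconjBy_unitary_iff.mp (semiconjBy_fourStringBraid_neutral hζ p)
  rw [coe_unitaryC_mul_inv, coe_unitaryC_mul_inv] at h1
  obtain ⟨θ, hθ, h⟩ := exists_mon_adjacent_pow (d := d) a.val
  have h2 := h1.pow_right a.val
  rw [h, h, ZMod.natCast_zmod_val, SemiconjBy, mul_smul_comm, smul_mul_assoc] at h2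
  rw [pairExponent_neg_right, pairExponent_neg_right]
  exact smul_right_injective _ hθ h2

/-- The braid commutes with the part away from the two pairs, raises the neutral pair and lowers the
other one. Putting the factors in order costs the same phase before and after: a neutral pair
contributes none, and `m` is trivial between the two positions of the other pair. -/
theorem fourStringBraid_mul_mon {m : ℕ →₀ ZMod d} {p : ℕ} (h : VanishesAt m p) (a x y : ZMod d) :
    SemiconjBy (fourStringBraid hζ p : PF d ℕ)
      (monomial (m + pairExponent p a (-a) + pairExponent (p + 1) x y) 1)
      (monomial (m + pairExponent p x y + pairExponent (p + 1) a (-a)) 1) := by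
  have e1 : (monomial m 1 * (monomial (pairExponent p a (-a)) 1 *
      monomial (pairExponent (p + 1) x y) 1) : PF d ℕ) =
      (ZMod.stdAddChar (reorderExponent m (pairExponent p x y)) : ℂ) •
      monomial (m + pairExponent p a (-a) + pairExponent (p + 1) x y) 1 := by
    rw [mon_mul_mon, reorderExponent_pair_pair (by omega), mul_smul_comm, mon_mul_mon,
      reorderExponent_add_right, reorderExponent_pair_succ h, pairExponent_neg_right,
      reorderExponent_adjacent_right, h.2.1, add_assoc]
    simp
  have e2 : (monomial m 1 * (monomial (pairExponent (p + 1) a (-a)) 1 *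
      monomial (pairExponent p x y) 1) : PF d ℕ) =
      (ZMod.stdAddChar (reorderExponent m (pairExponent p x y)) : ℂ) •
      monomial (m + pairExponent p x y + pairExponent (p + 1) a (-a)) 1 := by
    rw [mon_mul_mon, pairExponent_neg_right, reorderExponent_adjacent_left,
      pairExponent_apply_of_ne _ _ (by omega) (by omega), mul_smul_comm, mon_mul_mon,
      reorderExponent_add_right, reorderExponent_adjacent_right,
      show 2 * (p + 1) + 1 = 2 * p + 3 by ring, h.2.2.2, add_assoc, add_comm (adjacentExponent _ _)]
    simp
  have h0 : SemiconjBy (fourStringBraid hζ p : PF d ℕ) (monomial m 1) (monomial m 1) :=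
    commute_fourStringBraid_mon hζ h
  have h1 := h0.mul_right ((semiconjBy_fourStringBraid_neutralPair hζ p a).mul_right
    (semiconjBy_fourStringBraid_pair hζ p x y))
  rw [e1, e2, SemiconjBy, mul_smul_comm, smul_mul_assoc] at h1
  exact smul_right_injective _ (stdAddChar_ne_zero _) h1

variable {hζ} {φ : PF d ℕ →ₗ[ℂ] ℂ}

theorem IsBraidInvariant.apply_eq_of_semiconjBy (hinv : IsBraidInvariant hζ φ) {p : ℕ} {x y : PF d ℕ}
    (h : SemiconjBy (fourStringBraid hζ p : PF d ℕ) x y) : φ y = φ x := by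
  rw [← hinv (fourStringBraid hζ p) (Subgroup.subset_closure ⟨p, rfl⟩) x, h.eq, mul_assoc]
  have h1 : ((fourStringBraid hζ p : unitary (PF d ℕ)) : PF d ℕ) *
      ((fourStringBraid hζ p)⁻¹ : unitary (PF d ℕ)) = 1 := by
    rw [← Submonoid.coe_mul, mul_inv_cancel, Submonoid.coe_one]
  rw [h1, mul_one]

theorem IsBraidInvariant.apply_swap (hinv : IsBraidInvariant hζ φ) {m : ℕ →₀ ZMod d} {p : ℕ} (h : VanishesAt m p)
    (a x y : ZMod d) :
    φ (monomial (m + pairExponent p x y + pairExponent (p + 1) a (-a)) 1) =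
      φ (monomial (m + pairExponent p a (-a) + pairExponent (p + 1) x y) 1) :=
  hinv.apply_eq_of_semiconjBy (fourStringBraid_mul_mon hζ h a x y)

end BraidAction

theorem reorderExponent_pair_pair_swap {d : ℕ} {p r : ℕ} (h : p < r) (x y x' y' : ZMod d) :
    reorderExponent (pairExponent r x y) (pairExponent p x' y') = -((x + y) * (x' + y')) := by
  simp only [pairExponent, reorderExponent_add_left, reorderExponent_add_right,
    reorderExponent_single]
  rw [if_pos (by omega), if_pos (by omega), if_pos (by omega), if_pos (by omega)]
  ring

/-! ### Cauchy-Schwarz and sequences with constant correlations -/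

section States

variable {d : ℕ} [NeZero d] {ι : Type} [LinearOrder ι] {φ : PF d ι →ₗ[ℂ] ℂ}

/-- Polarisation: the values on `x + y` and `x + I • y` are real, which fixes the imaginary and the
real part respectively. -/
theorem IsState.apply_star_mul (hφ : IsState φ) (x y : PF d ι) :
    (starRingEnd ℂ) (φ (star y * x)) = φ (star x * y) := by
  have him (z : PF d ι) : (φ (star z * z)).im = 0 := (Complex.nonneg_iff.mp (hφ.2 z)).2.symm
  have h1 := him (x + y)
  have h2 := him (x + Complex.I • y)
  have h3 := him x
  have h4 := him y
  simp only [star_add, star_smul, add_mul, mul_add, map_add, smul_mul_assoc, mul_smul_comm,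
    map_smul, smul_eq_mul, Complex.add_im, Complex.mul_im, Complex.star_def, Complex.conj_I,
    Complex.neg_re, Complex.neg_im, Complex.I_re, Complex.I_im, Complex.mul_re] at h1 h2
  apply Complex.ext <;> simp only [Complex.conj_re, Complex.conj_im] <;> linarith

/-- The positive semidefinite form attached to a state. -/
@[reducible] noncomputable def IsState.core (hφ : IsState φ) : PreInnerProductSpace.Core ℂ (PF d ι) where
  inner x y := φ (star x * y)
  conj_inner_symm x y := hφ.apply_star_mul x y
  re_inner_nonneg x := (Complex.nonneg_iff.mp (hφ.2 x)).1
  add_left x y z := by simp [add_mul]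
  smul_left x y r := by simp

theorem IsState.norm_sq_apply_le (hφ : IsState φ) (x y : PF d ι) :
    ‖φ (star x * y)‖ ^ 2 ≤ (φ (star x * x)).re * (φ (star y * y)).re := by
  have h := @InnerProductSpace.Core.inner_mul_inner_self_le ℂ (PF d ι) _ _ _ hφ.core x y
  change ‖φ (star x * y)‖ * ‖φ (star y * x)‖ ≤ _ at h
  rw [← hφ.apply_star_mul y x, RCLike.norm_conj, ← sq] at h
  exact h

theorem star_mon_mul_self (m : ι →₀ ZMod d) :
    (star (monomial m 1) * monomial m 1 : PF d ι) = 1 :=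
  (Unitary.mem_iff.mp (monomial_mem_unitary m)).1

theorem mon_mul_star_self (m : ι →₀ ZMod d) :
    (monomial m 1 * star (monomial m 1) : PF d ι) = 1 :=
  (Unitary.mem_iff.mp (monomial_mem_unitary m)).2

theorem IsState.norm_apply_mon_le (hφ : IsState φ) (m : ι →₀ ZMod d) :
    ‖φ (monomial m 1)‖ ≤ 1 := by
  have h := hφ.norm_sq_apply_le 1 (monomial m 1)
  rw [star_mon_mul_self, star_one, one_mul, one_mul, hφ.1, Complex.one_re, one_mul] at h
  exact (sq_le_one_iff₀ (norm_nonneg _)).mp h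

/-- The offset `k` makes the formula available for disjoint blocks of the sequence. -/
theorem IsState.re_apply_sum (hφ : IsState φ) {w : ℕ → PF d ι} {γ : ℂ}
    (h1 : ∀ i, φ (star (w i) * w i) = 1) (h : ∀ i j, i < j → φ (star (w i) * w j) = γ) (k n : ℕ) :
    (φ (star (∑ i ∈ Finset.range n, w (k + i)) * ∑ i ∈ Finset.range n, w (k + i))).re =
      n + n * (n - 1) * γ.re := by
  induction n with
  | zero => simp
  | succ n ih =>
    have e : φ (star (∑ i ∈ Finset.range n, w (k + i)) * w (k + n)) = n * γ := by
      rw [star_sum, Finset.sum_mul, map_sum,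
        Finset.sum_congr rfl fun i hi => h (k + i) (k + n) (by simpa using hi)]
      simp
    have e' : φ (star (w (k + n)) * ∑ i ∈ Finset.range n, w (k + i)) =
        (starRingEnd ℂ) (n * γ) := by
      rw [← e, hφ.apply_star_mul]
    rw [Finset.sum_range_succ, star_add, add_mul, mul_add, mul_add, map_add, map_add, map_add, e,
      e', h1, Complex.add_re, Complex.add_re, Complex.add_re, ih]
    simp
    ring

/-- A constant correlation in an infinite sequence is real and non-negative. -/
theorem IsState.norm_le_re_of_correlation (hφ : IsState φ) {w : ℕ → PF d ι} {γ : ℂ}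
    (h1 : ∀ i, φ (star (w i) * w i) = 1) (h : ∀ i j, i < j → φ (star (w i) * w j) = γ) :
    ‖γ‖ ≤ γ.re := by
  by_contra! hlt
  -- Cauchy-Schwarz for two consecutive blocks of length `n` gives `n ^ 2 * ‖γ‖ ≤ n + n * (n - 1) *
  -- γ.re`, that is `n * (‖γ‖ - γ.re) ≤ 1 - γ.re`; this `n` violates it.
  obtain ⟨n, hn⟩ := exists_nat_gt (max 0 ((1 - γ.re) / (‖γ‖ - γ.re)))
  have hn0 : 0 < (n : ℝ) := (le_max_left _ _).trans_lt hn
  replace hn := (le_max_right _ _).trans_lt hn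
  rw [div_lt_iff₀ (sub_pos.mpr hlt)] at hn
  set A := ∑ i ∈ Finset.range n, w (0 + i) with hA
  set B := ∑ i ∈ Finset.range n, w (n + i) with hB
  have hAB : φ (star A * B) = n * (n * γ) := by
    rw [hA, hB, star_sum, Finset.sum_mul, map_sum]
    have e (i : ℕ) (hi : i ∈ Finset.range n) :
        φ (star (w (0 + i)) * ∑ j ∈ Finset.range n, w (n + j)) = n * γ := by
      rw [Finset.mul_sum, map_sum, Finset.sum_congr rfl fun j _ => h (0 + i) (n + j)
        (by have := Finset.mem_range.mp hi; omega)]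
      simp
    rw [Finset.sum_congr rfl e]
    simp
  have hcs := hφ.norm_sq_apply_le A B
  rw [hAB, hA, hB, hφ.re_apply_sum h1 h, hφ.re_apply_sum h1 h, ← sq] at hcs
  have hpos : 0 ≤ (n : ℝ) + n * (n - 1) * γ.re := by
    rw [← hφ.re_apply_sum h1 h 0 n]
    exact (Complex.nonneg_iff.mp (hφ.2 _)).1
  have h2 := (sq_le_sq₀ (norm_nonneg _) hpos).mp hcs
  rw [norm_mul, norm_mul, Complex.norm_natCast] at h2
  have h3 : (n : ℝ) * ‖γ‖ ≤ 1 + (n - 1) * γ.re := by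
    refine le_of_mul_le_mul_left ?_ hn0
    linarith
  linarith

/-- A vector with constant inner product against an orthonormal sequence is orthogonal to it. -/
theorem IsState.eq_zero_of_orthonormal (hφ : IsState φ) {w : ℕ → PF d ι} {y : PF d ι} {α : ℂ}
    (h1 : ∀ i, φ (star (w i) * w i) = 1) (h : ∀ i j, i < j → φ (star (w i) * w j) = 0)
    (hy : ∀ i, φ (star y * w i) = α) : α = 0 := by
  by_contra hα
  -- Cauchy-Schwarz against the sum of `n` orthonormal vectors gives `n ^ 2 * ‖α‖ ^ 2 ≤ n * φ (star
  -- y * y)`, which fails for this `n`.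
  obtain ⟨n, hn⟩ := exists_nat_gt (max 0 ((φ (star y * y)).re / ‖α‖ ^ 2))
  have hn0 : 0 < (n : ℝ) := (le_max_left _ _).trans_lt hn
  replace hn := (le_max_right _ _).trans_lt hn
  rw [div_lt_iff₀ (by positivity)] at hn
  have hcs := hφ.norm_sq_apply_le y (∑ i ∈ Finset.range n, w (0 + i))
  rw [hφ.re_apply_sum h1 h, Finset.mul_sum, map_sum, Finset.sum_congr rfl fun i _ => hy (0 + i)]
    at hcs
  simp only [Finset.sum_const, Finset.card_range, nsmul_eq_mul, norm_mul, Complex.norm_natCast,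
    Complex.zero_re, mul_zero, add_zero, mul_pow] at hcs
  nlinarith

end States

/-! ### Vanishing on charged monomials, and neutrality -/

section Vanishing

variable {d : ℕ} [NeZero d] {ζ : ℂ} {hζ : IsTwistRoot d ζ} {φ : PF d ℕ →ₗ[ℂ] ℂ}

/-- An empty pair is the neutral pair with `a = 0`, so any pair may hop to a free neighbouring
place. -/
theorem apply_correlation_succ_right (hinv : IsBraidInvariant hζ φ) (x y : ZMod d) {i j : ℕ}
    (h : i < j) :
    φ (monomial (-pairExponent i x y + pairExponent (j + 1) x y) 1) =
      φ (monomial (-pairExponent i x y + pairExponent j x y) 1) := by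
  have hv : VanishesAt (-pairExponent i x y) j := by
    refine ⟨?_, ?_, ?_, ?_⟩ <;>
      rw [Finsupp.neg_apply, pairExponent_apply_of_ne _ _ (by omega) (by omega), neg_zero]
  have h1 := hinv.apply_swap hv 0 x y
  simpa [pairExponent_zero] using h1.symm

theorem apply_correlation_succ_left (hinv : IsBraidInvariant hζ φ) (x y : ZMod d) {i j : ℕ}
    (h : i + 1 < j) :
    φ (monomial (-pairExponent (i + 1) x y + pairExponent j x y) 1) =
      φ (monomial (-pairExponent i x y + pairExponent j x y) 1) := by
  have hv : VanishesAt (pairExponent j x y) i := by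
    refine ⟨?_, ?_, ?_, ?_⟩ <;>
      rw [pairExponent_apply_of_ne _ _ (by omega) (by omega)]
  have h1 := hinv.apply_swap hv 0 (-x) (-y)
  rw [neg_zero, pairExponent_zero, pairExponent_zero, add_zero, add_zero, ← neg_pairExponent,
    ← neg_pairExponent, add_comm, add_comm _ (-pairExponent (i + 1) x y)] at h1
  exact h1.symm

theorem apply_correlation_eq (hinv : IsBraidInvariant hζ φ) (x y : ZMod d) {i j : ℕ} (h : i < j) :
    φ (monomial (-pairExponent i x y + pairExponent j x y) 1) =
      φ (monomial (-pairExponent 0 x y + pairExponent 1 x y) 1) := by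
  have h1 (i j : ℕ) (h : i < j) : φ (monomial (-pairExponent i x y + pairExponent j x y) 1) =
      φ (monomial (-pairExponent i x y + pairExponent (i + 1) x y) 1) := by
    induction j, h using Nat.le_induction with
    | base => rfl
    | succ j hj ih => rw [apply_correlation_succ_right hinv x y (by omega), ih]
  rw [h1 i j h]
  induction i generalizing j with
  | zero => rfl
  | succ i ih =>
    -- The right member is first moved away to `i + 3`, which frees the places needed for the hop of
    -- the left member, and is brought back afterwards.
    rw [← h1 (i + 1) (i + 3) (by omega), apply_correlation_succ_left hinv x y (by omega),
      h1 i (i + 3) (by omega)]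
    exact ih (j := i + 1) (by omega)

/-- Both `w i` and `star (w i)` are sequences of constant correlation. Since `w j * star (w i)`
equals `star (w i) * w j` up to the factor `q ^ ((x + y) ^ 2)`, the correlations are `c` and the
conjugate of `q ^ ((x + y) ^ 2) * c`. Both are non-negative reals of equal modulus, hence equal, and
the factor is not `1` because `ZMod d` has no nilpotents. -/
theorem correlation_eq_zero (hd : Squarefree d) (hφ : IsState φ) (hinv : IsBraidInvariant hζ φ)
    {x y : ZMod d} (hxy : x + y ≠ 0) {i j : ℕ} (hij : i < j) :
    φ (star (monomial (pairExponent i x y) 1) * monomial (pairExponent j x y) 1) = 0 := by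
  set γ := φ (monomial (-pairExponent 0 x y + pairExponent 1 x y) 1) with hγ
  have hself (p : ℕ) : reorderExponent (pairExponent p x y) (pairExponent p x y) = -(y * x) := by
    simp only [pairExponent, reorderExponent_add_left, reorderExponent_add_right,
      reorderExponent_single]
    simp
  have e1 (i j : ℕ) (h : i < j) :
      φ (star (monomial (pairExponent i x y) 1) * monomial (pairExponent j x y) 1) =
        ZMod.stdAddChar (-(y * x)) * γ := by
    rw [star_mon, hself, smul_mul_assoc, mon_mul_mon, reorderExponent_neg_left,
      reorderExponent_pair_pair h, map_smul, map_smul, apply_correlation_eq hinv x y h]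
    simp [hγ]
  have e2 (i j : ℕ) (h : i < j) :
      φ (star (star (monomial (pairExponent i x y) 1)) * star (monomial (pairExponent j x y) 1)) =
        (starRingEnd ℂ) (ZMod.stdAddChar ((x + y) * (x + y)) *
          (ZMod.stdAddChar (-(y * x)) * γ)) := by
    rw [← hφ.apply_star_mul, star_star]
    refine congrArg (starRingEnd ℂ) ?_
    rw [star_mon, hself, mul_smul_comm, mon_mul_mon, reorderExponent_neg_right,
      reorderExponent_pair_pair_swap h, map_smul, map_smul, add_comm (pairExponent j x y),
      apply_correlation_eq hinv x y h]
    simp only [smul_eq_mul, neg_neg, hγ]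
    ring
  rw [e1 i j hij]
  have g1 := hφ.norm_le_re_of_correlation (fun i => by rw [star_mon_mul_self, hφ.1]) e1
  have g2 := hφ.norm_le_re_of_correlation (fun i => by rw [star_star, mon_mul_star_self, hφ.1]) e2
  set c := ZMod.stdAddChar (-(y * x)) * γ with hc
  have hs : (x + y) * (x + y) ≠ 0 := by
    have : IsReduced (ZMod d) := isReduced_zmod.mpr (Or.inl hd)
    intro h0
    exact hxy (IsReduced.eq_zero _ ⟨2, by rw [sq, h0]⟩)
  have hq : (ZMod.stdAddChar ((x + y) * (x + y)) : ℂ) ≠ 1 := by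
    intro h0
    exact hs (ZMod.injective_stdAddChar (by rw [h0]; simp))
  by_contra hne
  have hre (z : ℂ) (h : ‖z‖ ≤ z.re) : z = ‖z‖ := by
    have h1 : z.re = ‖z‖ := le_antisymm (Complex.re_le_norm z) h
    have h2 : z.im = 0 := by
      have h3 := Complex.sq_norm z
      rw [Complex.normSq_apply, ← h1] at h3
      nlinarith
    exact Complex.ext (by simp [h1]) (by simp [h2])
  have k1 := hre _ g1
  have k2 := hre _ g2
  rw [RCLike.norm_conj, norm_mul, norm_stdAddChar, one_mul, ← k1] at k2
  have k3 := congrArg (starRingEnd ℂ) k2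
  rw [Complex.conj_conj] at k3
  have k4 : (starRingEnd ℂ) c = c := by
    rw [k1, Complex.conj_ofReal]
  rw [k4] at k3
  exact hq (mul_right_cancel₀ hne (k3.trans (one_mul c).symm))

/-- An invariant state vanishes on monomials whose last pair is charged. -/
theorem apply_eq_zero_of_last_charged (hd : Squarefree d) (hφ : IsState φ)
    (hinv : IsBraidInvariant hζ φ) {m : ℕ →₀ ZMod d} {k : ℕ} (hm : ∀ j, 2 * k ≤ j → m j = 0)
    {x y : ZMod d} (hxy : x + y ≠ 0) : φ (monomial (m + pairExponent k x y) 1) = 0 := by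
  have hstep (i : ℕ) : φ (monomial (m + pairExponent (k + i) x y) 1) =
      φ (monomial (m + pairExponent k x y) 1) := by
    induction i with
    | zero => rfl
    | succ i ih =>
      have hv : VanishesAt m (k + i) :=
        ⟨hm _ (by omega), hm _ (by omega), hm _ (by omega), hm _ (by omega)⟩
      have h1 := hinv.apply_swap hv 0 x y
      rw [← ih]
      simpa [pairExponent_zero, add_assoc] using h1.symm
  -- All places from `k` on are free in `m`, so the charged pair can be pushed arbitrarily far right
  -- without changing the value; the pushed pairs are the orthonormal sequence.
  refine hφ.eq_zero_of_orthonormal (w := fun i => monomial (pairExponent (k + i) x y) 1)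
    (y := star (monomial m 1)) (fun i => by rw [star_mon_mul_self, hφ.1])
    (fun i j h => correlation_eq_zero hd hφ hinv hxy (by omega)) fun i => ?_
  rw [star_star, mon_mul_mon_of_le, hstep]
  intro j l hl hj
  have h1 := eq_or_eq_of_pairExponent_ne_zero hj
  by_contra! hlt
  exact hl (hm l (by omega))

/-- An invariant state vanishes on monomials with a charged pair. -/
theorem apply_eq_zero_of_charged (hd : Squarefree d) (hφ : IsState φ)
    (hinv : IsBraidInvariant hζ φ) {m : ℕ →₀ ZMod d} {k : ℕ}
    (hk : m (2 * k) + m (2 * k + 1) ≠ 0) : φ (monomial m 1) = 0 := by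
  -- Here `k` is the last charged pair and at most `n` neutral pairs follow it. Each induction step
  -- exchanges it with its right neighbour.
  have key (n : ℕ) : ∀ (m : ℕ →₀ ZMod d) (k : ℕ), m (2 * k) + m (2 * k + 1) ≠ 0 →
      (∀ l, k < l → m (2 * l) + m (2 * l + 1) = 0) → (∀ j, 2 * (k + n + 1) ≤ j → m j = 0) →
      φ (monomial m 1) = 0 := by
    induction n with
    | zero =>
      intro m k hk _ hz
      obtain ⟨m₀, hv, h0, hm⟩ := exists_erase_pairs m k
      have h2 : m (2 * k + 2) = 0 := hz _ (by omega)
      have h3 : m (2 * k + 3) = 0 := hz _ (by omega)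
      rw [hm, h2, h3, pairExponent_zero, add_zero]
      refine apply_eq_zero_of_last_charged hd hφ hinv (fun j hj => ?_) hk
      by_cases h4 : 2 * k + 4 ≤ j
      · rw [h0 j (Or.inr h4)]
        exact hz j (by omega)
      · obtain h5 | h5 | h5 | h5 : j = 2 * k ∨ j = 2 * k + 1 ∨ j = 2 * k + 2 ∨ j = 2 * k + 3 := by
          omega
        all_goals rw [h5]
        exacts [hv.1, hv.2.1, hv.2.2.1, hv.2.2.2]
    | succ n ih =>
      intro m k hk hn hz
      obtain ⟨m₀, hv, h0, hm⟩ := exists_erase_pairs m k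
      have h1 : m (2 * k + 3) = -m (2 * k + 2) :=
        eq_neg_of_add_eq_zero_right (hn (k + 1) (by omega))
      rw [hm, h1, hinv.apply_swap hv]
      have hp : ∀ j, 2 * k + 4 ≤ j → (m₀ + pairExponent k (m (2 * k + 2)) (-m (2 * k + 2)) +
          pairExponent (k + 1) (m (2 * k)) (m (2 * k + 1))) j = m j := by
        intro j hj
        rw [Finsupp.add_apply, Finsupp.add_apply, h0 j (Or.inr hj),
          pairExponent_apply_of_ne _ _ (by omega) (by omega),
          pairExponent_apply_of_ne _ _ (by omega) (by omega), add_zero, add_zero]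
      refine ih _ (k + 1) ?_ (fun l hl => ?_) (fun j hj => ?_)
      · simp only [Finsupp.add_apply, pairExponent_apply_even, pairExponent_apply_odd]
        rw [pairExponent_apply_of_ne _ _ (by omega) (by omega),
          pairExponent_apply_of_ne _ _ (by omega) (by omega)]
        rw [show 2 * (k + 1) = 2 * k + 2 by ring, hv.2.2.1, hv.2.2.2]
        simpa using hk
      · rw [hp _ (by omega), hp _ (by omega)]
        exact hn l (by omega)
      · rw [hp _ (by omega)]
        exact hz j (by omega)
  obtain ⟨N, hN⟩ : ∃ N, ∀ j ∈ m.support, j < N :=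
    ⟨m.support.sup id + 1, fun j hj => Nat.lt_succ_of_le (Finset.le_sup (f := id) hj)⟩
  have hN' (j : ℕ) (hj : N ≤ j) : m j = 0 := by
    by_contra h
    exact absurd (hN j (Finsupp.mem_support_iff.mpr h)) hj.not_gt
  have hb (l : ℕ) (hl : m (2 * l) + m (2 * l + 1) ≠ 0) : l ≤ N := by
    by_contra! h
    exact hl (by rw [hN' _ (by omega), hN' _ (by omega), add_zero])
  classical
  -- The last charged pair exists because the support is finite.
  have hne := Nat.findGreatest_spec (P := fun l => m (2 * l) + m (2 * l + 1) ≠ 0) (hb k hk) hk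
  set L := Nat.findGreatest (fun l => m (2 * l) + m (2 * l + 1) ≠ 0) N with hL
  refine key N m L hne (fun l hl => ?_) (fun j hj => hN' j (by omega))
  by_contra h
  exact absurd (Nat.le_findGreatest (P := fun l => m (2 * l) + m (2 * l + 1) ≠ 0) (hb l h) h)
    hl.not_ge

theorem IsBraidInvariant.isNeutral (hd : Squarefree d) (hφ : IsState φ)
    (hinv : IsBraidInvariant hζ φ) : IsNeutral φ := by
  intro q hq x hx
  induction hx using Submodule.span_induction with
  | zero => exact map_zero φ
  | add x y _ _ hx hy => rw [map_add, hx, hy, add_zero]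
  | smul a x _ hx => rw [map_smul, hx, smul_zero]
  | mem x hx =>
    obtain ⟨m, hm, rfl⟩ := hx
    -- The total charge is the sum of the charges of the pairs, so non-zero charge requires a
    -- charged pair.
    by_cases h : ∃ k, m (2 * k) + m (2 * k + 1) ≠ 0
    · obtain ⟨k, hk⟩ := h
      exact apply_eq_zero_of_charged hd hφ hinv hk
    · push Not at h
      refine absurd ?_ hq
      rw [← hm]
      obtain ⟨N, hN⟩ : ∃ N, ∀ j ∈ m.support, j < N :=
        ⟨m.support.sup id + 1, fun j hj => Nat.lt_succ_of_le (Finset.le_sup (f := id) hj)⟩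
      have hs : (m.sum fun _ a => a) = ∑ j ∈ Finset.range (2 * N), m j :=
        Finsupp.sum_of_support_subset _ (fun j hj => by
          have := hN j hj
          exact Finset.mem_range.mpr (by omega)) _ (fun _ _ => rfl)
      rw [hs]
      clear hs hN
      induction N with
      | zero => simp
      | succ N ih =>
        rw [mul_add, mul_one, Finset.sum_range_succ, Finset.sum_range_succ, ih, zero_add, h N]

end Vanishing

/-! ### Functionals given on monomials, and positivity through Gram matrices -/

section Functionals

theorem stdAddChar_sum {d : ℕ} [NeZero d] {κ : Type*} (s : Finset κ) (f : κ → ZMod d) :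
    (ZMod.stdAddChar (∑ k ∈ s, f k) : ℂ) = ∏ k ∈ s, (ZMod.stdAddChar (f k) : ℂ) := by
  classical
  induction s using Finset.induction_on with
  | empty => simp
  | insert a s ha ih => rw [Finset.sum_insert ha, Finset.prod_insert ha, AddChar.map_add_eq_mul, ih]

variable {d : ℕ} {ι : Type}

/-- The linear functional with prescribed values on monomials. -/
noncomputable def functional (f : (ι →₀ ZMod d) → ℂ) : PF d ι →ₗ[ℂ] ℂ :=
  Finsupp.linearCombination ℂ f

theorem functional_mon (f : (ι →₀ ZMod d) → ℂ) (m : ι →₀ ZMod d) :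
    functional f (monomial m 1) = f m :=
  (Finsupp.linearCombination_single ℂ 1 m).trans (one_smul ℂ _)

/-- The element with prescribed coefficients. -/
noncomputable def ofCoeff (x : (ι →₀ ZMod d) →₀ ℂ) : PF d ι := x

theorem ofCoeff_eq_sum (x : (ι →₀ ZMod d) →₀ ℂ) :
    (ofCoeff x : PF d ι) = ∑ m ∈ x.support, monomial m (x m) :=
  (Finsupp.sum_single x).symm

variable [LinearOrder ι] [NeZero d]

/-- The Gram matrix of the monomials for a functional. -/
noncomputable def gram (φ : PF d ι →ₗ[ℂ] ℂ) : Matrix (ι →₀ ZMod d) (ι →₀ ZMod d) ℂ :=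
  Matrix.of fun m n => φ (star (monomial m 1) * monomial n 1)

/-- As monomials form a basis, positivity of a functional is positive semidefiniteness of its Gram
matrix, a property that passes to entrywise products. -/
theorem sum_gram (φ : PF d ι →ₗ[ℂ] ℂ) (x : (ι →₀ ZMod d) →₀ ℂ) :
    (x.sum fun m a => x.sum fun n b => star a * gram φ m n * b) =
      φ (star (ofCoeff x) * ofCoeff x) := by
  have h : φ (star (ofCoeff x) * ofCoeff x) = ∑ m ∈ x.support, ∑ n ∈ x.support,
      φ (star (monomial m (x m)) * monomial n (x n)) := by
    conv_lhs => rw [ofCoeff_eq_sum x]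
    rw [star_sum, Finset.sum_mul_sum, map_sum]
    exact Finset.sum_congr rfl fun m _ => map_sum _ _ _
  rw [h]
  refine Finset.sum_congr rfl fun m _ => Finset.sum_congr rfl fun n _ => ?_
  rw [monomial_eq_smul m (x m), monomial_eq_smul n (x n), star_smul, smul_mul_smul_comm, map_smul,
    smul_eq_mul]
  exact mul_right_comm _ _ _

theorem IsState.posSemidef_gram {φ : PF d ι →ₗ[ℂ] ℂ} (hφ : IsState φ) :
    (gram φ).PosSemidef := by
  refine ⟨?_, fun x => ?_⟩
  · ext m n
    exact hφ.apply_star_mul _ _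
  · rw [sum_gram]
    exact hφ.2 _

theorem isState_of_posSemidef_gram {φ : PF d ι →ₗ[ℂ] ℂ} (h1 : φ 1 = 1)
    (h : ∀ x : (ι →₀ ZMod d) →₀ ℂ, 0 ≤ x.sum fun m a => x.sum fun n b => star a * gram φ m n * b) :
    IsState φ := by
  exact ⟨h1, fun x => (sum_gram φ x) ▸ h x⟩

theorem gram_eq (φ : PF d ι →ₗ[ℂ] ℂ) (m n : ι →₀ ZMod d) :
    gram φ m n = ZMod.stdAddChar (reorderExponent m (m - n)) * φ (monomial (n - m) 1) := by
  rw [gram, Matrix.of_apply, star_mon, smul_mul_assoc, mon_mul_mon, smul_smul,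
    ← AddChar.map_add_eq_mul, reorderExponent_neg_left, ← reorderExponent_neg_right,
    ← reorderExponent_add_right, map_smul, smul_eq_mul, ← sub_eq_add_neg, neg_add_eq_sub]

end Functionals

/-! ### Decomposition of exponents into pairs -/

section Pairs

variable {d : ℕ}

theorem reorderExponent_fin_two (m n : Fin 2 →₀ ZMod d) :
    reorderExponent m n = -(m 1 * n 0) := by
  have e (m : Fin 2 →₀ ZMod d) : m = Finsupp.single 0 (m 0) + Finsupp.single 1 (m 1) := by
    ext i
    fin_cases i <;> simp
  rw [e m, e n]
  simp only [reorderExponent_add_left, reorderExponent_add_right, reorderExponent_single]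
  simp

/-- The restriction of an exponent to the `k`-th pair. -/
noncomputable def pairRestrict (k : ℕ) (m : ℕ →₀ ZMod d) : Fin 2 →₀ ZMod d :=
  Finsupp.equivFunOnFinite.symm fun i => m (2 * k + i)

theorem pairRestrict_zero_apply (k : ℕ) (m : ℕ →₀ ZMod d) : pairRestrict k m 0 = m (2 * k) := rfl

theorem pairRestrict_one_apply (k : ℕ) (m : ℕ →₀ ZMod d) :
    pairRestrict k m 1 = m (2 * k + 1) := rfl

theorem pairRestrict_eq_of_eq {k : ℕ} {m : ℕ →₀ ZMod d} {a : Fin 2 →₀ ZMod d}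
    (h0 : m (2 * k) = a 0) (h1 : m (2 * k + 1) = a 1) : pairRestrict k m = a := by
  ext i
  fin_cases i
  exacts [h0, h1]

theorem pairRestrict_sub (k : ℕ) (m n : ℕ →₀ ZMod d) :
    pairRestrict k (m - n) = pairRestrict k m - pairRestrict k n := by
  ext i
  fin_cases i <;> rfl

theorem eq_sum_adjacent {m : ℕ →₀ ZMod d} (h : ∀ k, m (2 * k) + m (2 * k + 1) = 0) {N : ℕ}
    (hN : ∀ j, 2 * N ≤ j → m j = 0) :
    m = ∑ k ∈ Finset.range N, adjacentExponent (2 * k) (m (2 * k)) := by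
  have ha (k j : ℕ) (a : ZMod d) : adjacentExponent (2 * k) a j =
      if k = j / 2 then (if j % 2 = 0 then a else -a) else 0 := by
    rw [← pairExponent_neg_right, pairExponent_apply]
    split_ifs <;> first | omega | simp
  ext j
  rw [Finsupp.finsetSum_apply]
  simp only [ha]
  rw [Finset.sum_ite_eq']
  split_ifs with h1 h2
  · congr 1
    omega
  · rw [← eq_neg_of_add_eq_zero_right (h (j / 2))]
    congr 1
    omega
  · rw [Finset.mem_range] at h1
    exact hN j (by omega)

theorem reorderExponent_sum_right {ι κ : Type} [LinearOrder ι] (m : ι →₀ ZMod d) (s : Finset κ)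
    (f : κ → ι →₀ ZMod d) :
    reorderExponent m (∑ k ∈ s, f k) = ∑ k ∈ s, reorderExponent m (f k) :=
  map_sum (AddMonoidHom.mk' (reorderExponent m) (reorderExponent_add_right m)) f s

/-- Between different pairs only the charge of the pair of `n` enters, and it is zero; the phase
therefore splits over the pairs even though `m` is arbitrary. -/
theorem reorderExponent_neutral_right (m : ℕ →₀ ZMod d) {n : ℕ →₀ ZMod d}
    (h : ∀ k, n (2 * k) + n (2 * k + 1) = 0) {N : ℕ} (hN : ∀ j, 2 * N ≤ j → n j = 0) :
    reorderExponent m n =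
      ∑ k ∈ Finset.range N, reorderExponent (pairRestrict k m) (pairRestrict k n) := by
  conv_lhs => rw [eq_sum_adjacent h hN]
  rw [reorderExponent_sum_right]
  refine Finset.sum_congr rfl fun k _ => ?_
  rw [reorderExponent_adjacent_right, reorderExponent_fin_two]
  rfl

theorem pairEmbedding_monomial (k : ℕ) (a : Fin 2 →₀ ZMod d) (z : ℂ) :
    pairEmbedding k (monomial a z) = monomial (pairExponent k (a 0) (a 1)) z := by
  have e : a = Finsupp.single 0 (a 0) + Finsupp.single 1 (a 1) := by
    ext i
    fin_cases i <;> simp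
  have h : Finsupp.mapDomain (pairIndex k) a = pairExponent k (a 0) (a 1) := by
    conv_lhs => rw [e]
    rw [Finsupp.mapDomain_add, Finsupp.mapDomain_single, Finsupp.mapDomain_single]
    rfl
  rw [← h]
  exact Finsupp.mapDomain_single

theorem exists_pairBound (m : ℕ →₀ ZMod d) : ∃ N, ∀ j, 2 * N ≤ j → m j = 0 := by
  refine ⟨m.support.sup id + 1, fun j hj => ?_⟩
  by_contra h
  have := Finset.le_sup (f := id) (Finsupp.mem_support_iff.mpr h)
  simp only [id] at this
  omega

theorem IsNeutral.apply_mon {ρ : PF d (Fin 2) →ₗ[ℂ] ℂ} (hρ : IsNeutral ρ) {a : Fin 2 →₀ ZMod d}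
    (ha : a 0 + a 1 ≠ 0) : ρ (monomial a 1) = 0 := by
  refine hρ _ ha _ (Submodule.subset_span ⟨a, ?_, rfl⟩)
  rw [Finsupp.sum_fintype _ _ (fun _ => rfl), Fin.sum_univ_two]

end Pairs

/-! ### Infinite products of a neutral state -/

section ProductStates

variable {d : ℕ}

/-- The infinite product of a functional on `PF_2`. -/
noncomputable def infiniteProduct (ρ : PF d (Fin 2) →ₗ[ℂ] ℂ) : PF d ℕ →ₗ[ℂ] ℂ :=
  functional fun m =>
    ∏ k ∈ Finset.range (exists_pairBound m).choose, ρ (monomial (pairRestrict k m) 1)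

variable [NeZero d] {ρ : PF d (Fin 2) →ₗ[ℂ] ℂ}

/-- Empty pairs contribute `ρ 1 = 1`, so the chosen bound in the definition may be replaced by any
other. -/
theorem infiniteProduct_mon (h1 : ρ 1 = 1) {m : ℕ →₀ ZMod d} {N : ℕ}
    (hN : ∀ j, 2 * N ≤ j → m j = 0) : infiniteProduct ρ (monomial m 1) =
      ∏ k ∈ Finset.range N, ρ (monomial (pairRestrict k m) 1) := by
  have key (N M : ℕ) (h : N ≤ M) (hN : ∀ j, 2 * N ≤ j → m j = 0) :
      ∏ k ∈ Finset.range N, ρ (monomial (pairRestrict k m) 1) =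
        ∏ k ∈ Finset.range M, ρ (monomial (pairRestrict k m) 1) := by
    refine Finset.prod_subset (Finset.range_mono h) fun k _ hk => ?_
    rw [Finset.mem_range, not_lt] at hk
    rw [pairRestrict_eq_of_eq (a := 0) (hN _ (by omega)) (hN _ (by omega)), ← one_def, h1]
  rw [infiniteProduct, functional_mon]
  have hM := (exists_pairBound m).choose_spec
  rcases le_total N (exists_pairBound m).choose with h | h
  · exact (key _ _ h hN).symm
  · exact key _ _ h hM

/-- If `m - n` is neutral in each pair, the reordering phase splits over the pairs. Otherwise both
sides vanish, because `ρ` is neutral. -/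
theorem gram_infiniteProduct (h1 : ρ 1 = 1) (hρ : IsNeutral ρ) {m n : ℕ →₀ ZMod d} {N : ℕ}
    (hm : ∀ j, 2 * N ≤ j → m j = 0) (hn : ∀ j, 2 * N ≤ j → n j = 0) :
    gram (infiniteProduct ρ) m n =
      ∏ k ∈ Finset.range N, gram ρ (pairRestrict k m) (pairRestrict k n) := by
  have hs : ∀ j, 2 * N ≤ j → (n - m) j = 0 := fun j hj => by
    rw [Finsupp.sub_apply, hm j hj, hn j hj, sub_zero]
  have hs' : ∀ j, 2 * N ≤ j → (m - n) j = 0 := fun j hj => by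
    rw [Finsupp.sub_apply, hm j hj, hn j hj, sub_zero]
  simp only [gram_eq]
  rw [infiniteProduct_mon h1 hs, Finset.prod_mul_distrib]
  by_cases hc : ∀ k, (m - n) (2 * k) + (m - n) (2 * k + 1) = 0
  · congr 1
    · rw [reorderExponent_neutral_right m hc hs', stdAddChar_sum]
      simp only [pairRestrict_sub]
    · simp only [pairRestrict_sub]
  · push Not at hc
    obtain ⟨k, hk⟩ := hc
    have hkN : k ∈ Finset.range N := by
      rw [Finset.mem_range]
      by_contra! h
      exact hk (by rw [hs' _ (by omega), hs' _ (by omega), add_zero])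
    have h0 : ρ (monomial (pairRestrict k (n - m)) 1) = 0 := by
      refine hρ.apply_mon fun h => hk ?_
      rw [pairRestrict_zero_apply, pairRestrict_one_apply] at h
      rw [← neg_sub n m, Finsupp.neg_apply, Finsupp.neg_apply, ← neg_add, h, neg_zero]
    have h2 : ρ (monomial (pairRestrict k n - pairRestrict k m) 1) = 0 := by
      rw [← pairRestrict_sub, h0]
    rw [Finset.prod_eq_zero hkN h0, mul_zero,
      Finset.prod_eq_zero (f := fun k => ρ (monomial (pairRestrict k n - pairRestrict k m) 1)) hkN h2,
      mul_zero]

/-- Schur product theorem: on finitely many monomials the Gram matrix is an entrywise product of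
pullbacks of the Gram matrix of `ρ`. -/
theorem isState_infiniteProduct (hρ : IsState ρ) (hn : IsNeutral ρ) :
    IsState (infiniteProduct ρ) := by
  refine isState_of_posSemidef_gram ?_ fun x => ?_
  · rw [one_def, infiniteProduct_mon hρ.1 (N := 0) (fun _ _ => rfl)]
    simp
  have hM (N : ℕ) : (Matrix.of fun m n : ℕ →₀ ZMod d =>
      ∏ k ∈ Finset.range N, gram ρ (pairRestrict k m) (pairRestrict k n)).PosSemidef := by
    induction N with
    | zero =>
      -- The empty product is the all-ones matrix, a pullback of the one-by-one identity.
      convert (Matrix.PosSemidef.one (n := Unit) (R := ℂ)).submatrix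
        (fun _ : ℕ →₀ ZMod d => ()) using 1
      ext m n
      simp
    | succ N ih =>
      have e : (Matrix.of fun m n : ℕ →₀ ZMod d =>
          ∏ k ∈ Finset.range (N + 1), gram ρ (pairRestrict k m) (pairRestrict k n)) =
          Matrix.hadamard (Matrix.of fun m n : ℕ →₀ ZMod d =>
            ∏ k ∈ Finset.range N, gram ρ (pairRestrict k m) (pairRestrict k n))
            ((gram ρ).submatrix (pairRestrict N) (pairRestrict N)) := by
        ext m n
        simp [Finset.prod_range_succ]
      rw [e]
      exact ih.hadamard (hρ.posSemidef_gram.submatrix (pairRestrict N))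
  obtain ⟨N, hN⟩ : ∃ N, ∀ m ∈ x.support, ∀ j, 2 * N ≤ j → m j = 0 := by
    choose B hB using fun m : ℕ →₀ ZMod d => exists_pairBound m
    refine ⟨x.support.sup B, fun m hm j hj => hB m j ?_⟩
    have := Finset.le_sup (f := B) hm
    omega
  convert (hM N).2 x using 1
  refine Finset.sum_congr rfl fun m hm => Finset.sum_congr rfl fun n hn' => ?_
  exact congrArg (fun z => star (x m) * z * x n)
    (gram_infiniteProduct hρ.1 hn (hN m hm) (hN n hn'))

theorem isInfiniteProduct_infiniteProduct (h1 : ρ 1 = 1) :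
    IsInfiniteProduct ρ (infiniteProduct ρ) := by
  -- The span of the monomials in the first `n` pairs. Multiplying on the right by an element of the
  -- next pair respects the order of the strings and creates no phase, so the factors peel off from
  -- the right.
  let A (n : ℕ) : Submodule ℂ (PF d ℕ) :=
    Submodule.span ℂ {x | ∃ m : ℕ →₀ ZMod d, (∀ j, 2 * n ≤ j → m j = 0) ∧ x = monomial m 1}
  have hmul (n : ℕ) (m : ℕ →₀ ZMod d) (hm : ∀ j, 2 * n ≤ j → m j = 0) (a : Fin 2 →₀ ZMod d) :
      (monomial m 1 * pairEmbedding n (monomial a 1) : PF d ℕ) =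
        monomial (m + pairExponent n (a 0) (a 1)) 1 := by
    rw [pairEmbedding_monomial, mon_mul_mon_of_le]
    intro j k hk hj
    have h2 := eq_or_eq_of_pairExponent_ne_zero hj
    by_contra! hlt
    exact hk (hm k (by omega))
  have hb (n : ℕ) (m : ℕ →₀ ZMod d) (hm : ∀ j, 2 * n ≤ j → m j = 0) (x y : ZMod d) :
      ∀ j, 2 * (n + 1) ≤ j → (m + pairExponent n x y) j = 0 := fun j hj => by
    rw [Finsupp.add_apply, hm j (by omega), pairExponent_apply_of_ne _ _ (by omega) (by omega),
      add_zero]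
  have hstep (n : ℕ) (X : PF d ℕ) (hX : X ∈ A n) (y : PF d (Fin 2)) :
      X * pairEmbedding n y ∈ A (n + 1) ∧
        infiniteProduct ρ (X * pairEmbedding n y) = infiniteProduct ρ X * ρ y := by
    induction hX using Submodule.span_induction with
    | zero => simp
    | add X X' _ _ h h' =>
      rw [add_mul, map_add, map_add, h.2, h'.2, add_mul]
      exact ⟨add_mem h.1 h'.1, rfl⟩
    | smul a X _ h =>
      rw [smul_mul_assoc, map_smul, map_smul, h.2, smul_mul_assoc]
      exact ⟨Submodule.smul_mem _ _ h.1, rfl⟩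
    | mem X hX =>
      obtain ⟨m, hm, rfl⟩ := hX
      induction y using induction_on with
      | h0 => simp
      | hadd y y' h h' =>
        rw [map_add, mul_add, map_add, map_add, h.2, h'.2, mul_add]
        exact ⟨add_mem h.1 h'.1, rfl⟩
      | hm a z =>
        rw [monomial_eq_smul a z, map_smul, mul_smul_comm, map_smul, map_smul, hmul n m hm]
        refine ⟨Submodule.smul_mem _ _ (Submodule.subset_span ⟨_, hb n m hm _ _, rfl⟩), ?_⟩
        rw [infiniteProduct_mon h1 (hb n m hm _ _), infiniteProduct_mon h1 hm,
          Finset.prod_range_succ, smul_eq_mul, smul_eq_mul, mul_left_comm]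
        refine congrArg₂ (· * ·) ?_ (congrArg (z * ·) ?_)
        · refine Finset.prod_congr rfl fun k hk => ?_
          have hk' := Finset.mem_range.mp hk
          congr 2
          refine pairRestrict_eq_of_eq ?_ ?_ <;>
            rw [Finsupp.add_apply, pairExponent_apply_of_ne _ _ (by omega) (by omega), add_zero]
          exacts [rfl, rfl]
        · congr 2
          refine pairRestrict_eq_of_eq ?_ ?_
          · rw [Finsupp.add_apply, pairExponent_apply_even, hm _ (by omega), zero_add]
          · rw [Finsupp.add_apply, pairExponent_apply_odd, hm _ (by omega), zero_add]
  have key (n : ℕ) : ∀ x : Fin n → PF d (Fin 2),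
      (List.ofFn fun k : Fin n => pairEmbedding (k : ℕ) (x k)).prod ∈ A n ∧
      infiniteProduct ρ (List.ofFn fun k : Fin n => pairEmbedding (k : ℕ) (x k)).prod =
        ∏ k : Fin n, ρ (x k) := by
    induction n with
    | zero =>
      intro x
      rw [List.ofFn_zero, List.prod_nil, one_def, infiniteProduct_mon h1 (N := 0) (fun _ _ => rfl)]
      refine ⟨Submodule.subset_span ⟨0, fun _ _ => rfl, rfl⟩, by simp⟩
    | succ n ih =>
      intro x
      have h := ih fun k => x k.castSucc
      have h2 := hstep n _ h.1 (x (Fin.last n))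
      rw [List.ofFn_succ', List.concat_eq_append, List.prod_append, List.prod_singleton,
        Fin.prod_univ_castSucc]
      refine ⟨h2.1, h2.2.trans ?_⟩
      rw [h.2]
  exact fun n x => (key n x).2

theorem infiniteProduct_mem_neutralProductStates (hρ : IsState ρ) (hn : IsNeutral ρ) :
    (infiniteProduct ρ : PF d ℕ → ℂ) ∈ neutralProductStates d :=
  ⟨ρ, hρ, hn, infiniteProduct ρ, isState_infiniteProduct hρ hn,
    isInfiniteProduct_infiniteProduct hρ.1, rfl⟩

end ProductStates

/-! ### The quadratic function `ζ ^ (x ^ 2)` -/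

section GaussWeight

variable {d : ℕ}

/-- The quadratic function `ζ ^ (x ^ 2)` on `ZMod d`. -/
noncomputable def gaussWeight (ζ : ℂ) (x : ZMod d) : ℂ := ζ ^ (x.val ^ 2)

variable {ζ : ℂ}

theorem gaussWeight_zero : gaussWeight ζ (0 : ZMod d) = 1 := by
  simp [gaussWeight]

variable [NeZero d]

theorem IsTwistRoot.norm_gaussWeight (hζ : IsTwistRoot d ζ) (x : ZMod d) :
    ‖gaussWeight ζ x‖ = 1 := by
  have h : ‖ζ‖ = 1 :=
    Complex.norm_eq_one_of_pow_eq_one hζ.2 (pow_ne_zero 2 (NeZero.ne d))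
  rw [gaussWeight, norm_pow, h, one_pow]

theorem IsTwistRoot.gaussWeight_mul_conj (hζ : IsTwistRoot d ζ) (x : ZMod d) :
    gaussWeight ζ x * (starRingEnd ℂ) (gaussWeight ζ x) = 1 := by
  rw [Complex.mul_conj, Complex.normSq_eq_norm_sq, hζ.norm_gaussWeight]
  simp

/-- The value `ζ ^ (n ^ 2)` depends only on `n` modulo `d`: in `(n + d * m) ^ 2` the cross term is
killed by `ζ ^ (2 * d) = q ^ d = 1` and the last term by `ζ ^ (d ^ 2) = 1`. The identity is then the
expansion of a square. -/
theorem IsTwistRoot.gaussWeight_add (hζ : IsTwistRoot d ζ) (x y : ZMod d) :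
    gaussWeight ζ (x + y) = gaussWeight ζ x * gaussWeight ζ y * ZMod.stdAddChar (x * y) := by
  obtain ⟨h2, hd⟩ := hζ
  have hq (n : ℕ) : (ZMod.stdAddChar (n : ZMod d) : ℂ) = ζ ^ (2 * n) := by
    rw [pow_mul, h2, ← Complex.exp_nat_mul]
    have := ZMod.stdAddChar_coe (N := d) n
    push_cast at this
    rw [this]
    congr 1
    ring
  have hmod (n m : ℕ) : ζ ^ ((n + d * m) ^ 2) = ζ ^ (n ^ 2) := by
    have e : (n + d * m) ^ 2 = n ^ 2 + 2 * (n * (d * m)) + d ^ 2 * m ^ 2 := by ring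
    rw [e, pow_add, pow_add, pow_mul ζ (d ^ 2), hd, one_pow, mul_one, ← hq]
    simp
  have hval (n : ℕ) : ζ ^ ((n : ZMod d).val ^ 2) = ζ ^ (n ^ 2) := by
    rw [ZMod.val_natCast, ← hmod (n % d) (n / d), Nat.mod_add_div]
  have hxy : x + y = ((x.val + y.val : ℕ) : ZMod d) := by simp
  have hxy' : x * y = ((x.val * y.val : ℕ) : ZMod d) := by simp
  simp only [gaussWeight]
  rw [hxy', hq, hxy, hval]
  ring

end GaussWeight

/-! ### The commuting neutral unitaries and their exchangeability -/

section NeutralUnitaries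

variable {d : ℕ}

/-- The exponent of a product of neutral monomials of the first `n` pairs. -/
noncomputable def neutralExponent {n : ℕ} (b : Fin n → ZMod d) : ℕ →₀ ZMod d :=
  ∑ k : Fin n, adjacentExponent (2 * (k : ℕ)) (b k)

theorem adjacentExponent_add (k : ℕ) (x y : ZMod d) :
    adjacentExponent k (x + y) = adjacentExponent k x + adjacentExponent k y := by
  simp only [adjacentExponent, Finsupp.single_add]
  abel

theorem adjacentExponent_zero (k : ℕ) : adjacentExponent k (0 : ZMod d) = 0 := by
  simp [adjacentExponent]

theorem neutralExponent_add {n : ℕ} (b b' : Fin n → ZMod d) :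
    neutralExponent (b + b') = neutralExponent b + neutralExponent b' := by
  simp only [neutralExponent, Pi.add_apply, adjacentExponent_add, Finset.sum_add_distrib]

theorem neutralExponent_zero {n : ℕ} : neutralExponent (0 : Fin n → ZMod d) = 0 := by
  simp [neutralExponent, adjacentExponent_zero]

theorem neutralExponent_apply_odd {n : ℕ} (b : Fin n → ZMod d) (k : Fin n) :
    neutralExponent b (2 * (k : ℕ) + 1) = -b k := by
  rw [neutralExponent, Finsupp.finsetSum_apply, Finset.sum_eq_single k]
  · rw [← pairExponent_neg_right, pairExponent_apply_odd]
  · intro l _ hl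
    have h : (l : ℕ) ≠ k := fun h => hl (Fin.ext h)
    rw [← pairExponent_neg_right, pairExponent_apply_of_ne _ _ (by omega) (by omega)]
  · simp

theorem reorderExponent_neutral {n : ℕ} (b b' : Fin n → ZMod d) :
    reorderExponent (neutralExponent b) (neutralExponent b') = ∑ k, b k * b' k := by
  conv_lhs => rw [neutralExponent.eq_1 b']
  rw [reorderExponent_sum_right]
  refine Finset.sum_congr rfl fun k _ => ?_
  rw [reorderExponent_adjacent_right, neutralExponent_apply_odd]
  ring

/-- Move the values of `a` to new positions. -/
def relocate {r n : ℕ} (f : Fin r → Fin n) (a : Fin r → ZMod d) : Fin n → ZMod d :=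
  ∑ k, Pi.single (f k) (a k)

theorem neutralExponent_single {n : ℕ} (k : Fin n) (x : ZMod d) :
    neutralExponent (Pi.single k x) = adjacentExponent (2 * (k : ℕ)) x := by
  rw [neutralExponent, Finset.sum_eq_single k]
  · rw [Pi.single_eq_same]
  · intro l _ hl
    rw [Pi.single_eq_of_ne hl, adjacentExponent_zero]
  · simp

theorem neutralExponent_relocate {r n : ℕ} (f : Fin r → Fin n) (a : Fin r → ZMod d) :
    neutralExponent (relocate f a) = ∑ k, adjacentExponent (2 * (f k : ℕ)) (a k) := by
  have h := map_sum (AddMonoidHom.mk' (neutralExponent (d := d) (n := n)) neutralExponent_add)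
    (fun k => Pi.single (f k) (a k)) Finset.univ
  refine h.trans (Finset.sum_congr rfl fun k _ => neutralExponent_single _ _)

theorem relocate_apply_of_injective {r n : ℕ} {f : Fin r → Fin n} (hf : Function.Injective f)
    (a : Fin r → ZMod d) (k : Fin r) : relocate f a (f k) = a k := by
  rw [relocate, Finset.sum_apply, Finset.sum_eq_single k]
  · rw [Pi.single_eq_same]
  · intro l _ hl
    exact Pi.single_eq_of_ne (fun h => hl (hf h.symm)) _
  · simp

theorem relocate_apply_of_notMem {r n : ℕ} {f : Fin r → Fin n} (a : Fin r → ZMod d) {j : Fin n}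
    (hj : ∀ k, f k ≠ j) : relocate f a j = 0 := by
  rw [relocate, Finset.sum_apply]
  exact Finset.sum_eq_zero fun k _ => Pi.single_eq_of_ne (hj k).symm _

theorem relocate_perm {r n : ℕ} (σ : Equiv.Perm (Fin n)) (f : Fin r → Fin n)
    (a : Fin r → ZMod d) : relocate (σ ∘ f) a ∘ σ = relocate f a := by
  funext j
  simp only [relocate, Function.comp_apply, Finset.sum_apply]
  refine Finset.sum_congr rfl fun k _ => ?_
  simp [Pi.single_apply]

/-- Injectivity is not required, since values sent to the same position add up. This allows products
of averages to be expanded over all maps. -/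
theorem sum_mul_relocate {r n : ℕ} (f : Fin r → Fin n) (a : Fin r → ZMod d) (t : Fin n → ZMod d) :
    ∑ j, t j * relocate f a j = ∑ k, t (f k) * a k := by
  simp only [relocate, Finset.sum_apply, Finset.mul_sum]
  rw [Finset.sum_comm]
  refine Finset.sum_congr rfl fun k _ => ?_
  simp [Pi.single_apply]

variable [NeZero d] {ζ : ℂ}

/-- A unitary representation of `ZMod d ^ n` by neutral elements of the first `n` pairs. -/
noncomputable def neutralUnitary (ζ : ℂ) {n : ℕ} (b : Fin n → ZMod d) : PF d ℕ :=
  (∏ k, gaussWeight ζ (b k)) • monomial (neutralExponent b) 1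

theorem neutralUnitary_zero {n : ℕ} : neutralUnitary ζ (0 : Fin n → ZMod d) = 1 := by
  simp [neutralUnitary, gaussWeight_zero, neutralExponent_zero, one_def]

/-- Neutral monomials multiply with the cocycle `q ^ (∑ k, b k * b' k)`, and the Gauss weights
trivialise it. -/
theorem IsTwistRoot.neutralUnitary_mul (hζ : IsTwistRoot d ζ) {n : ℕ} (b b' : Fin n → ZMod d) :
    neutralUnitary ζ b * neutralUnitary ζ b' = neutralUnitary ζ (b + b') := by
  rw [neutralUnitary, neutralUnitary, neutralUnitary, smul_mul_smul_comm, mon_mul_mon, smul_smul,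
    reorderExponent_neutral, stdAddChar_sum, ← Finset.prod_mul_distrib, ← Finset.prod_mul_distrib,
    neutralExponent_add]
  congr 1
  exact Finset.prod_congr rfl fun k _ => (hζ.gaussWeight_add _ _).symm

theorem IsTwistRoot.star_neutralUnitary (hζ : IsTwistRoot d ζ) {n : ℕ} (b : Fin n → ZMod d) :
    star (neutralUnitary ζ b) = neutralUnitary ζ (-b) := by
  have h1 : star (neutralUnitary ζ b) * neutralUnitary ζ b = 1 := by
    rw [neutralUnitary, star_smul, smul_mul_smul_comm, star_mon_mul_self, star_prod,
      ← Finset.prod_mul_distrib, Finset.prod_eq_one, one_smul]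
    intro k _
    rw [mul_comm]
    exact hζ.gaussWeight_mul_conj _
  calc _ = star (neutralUnitary ζ b) * (neutralUnitary ζ b * neutralUnitary ζ (-b)) := by
        rw [hζ.neutralUnitary_mul, add_neg_cancel, neutralUnitary_zero, mul_one]
    _ = _ := by rw [← mul_assoc, h1, one_mul]

theorem neutralUnitary_relocate_castLE {r n : ℕ} (h : r ≤ n) (a : Fin r → ZMod d) :
    neutralUnitary ζ (relocate (Fin.castLE h) a) = neutralUnitary ζ a := by
  rw [neutralUnitary, neutralUnitary, neutralExponent_relocate]
  congr 1
  have hi := Fin.castLE_injective h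
  rw [← Finset.prod_subset (Finset.subset_univ (Finset.univ.map ⟨_, hi⟩)), Finset.prod_map]
  · exact Finset.prod_congr rfl fun k _ => by
      rw [Function.Embedding.coeFn_mk, relocate_apply_of_injective hi]
  · intro j _ hj
    rw [relocate_apply_of_notMem, gaussWeight_zero]
    intro k hk
    exact hj (Finset.mem_map.mpr ⟨k, Finset.mem_univ _, hk⟩)

variable {φ : PF d ℕ →ₗ[ℂ] ℂ}

theorem IsState.norm_apply_neutralUnitary_le (hφ : IsState φ) (hζ : IsTwistRoot d ζ) {n : ℕ}
    (b : Fin n → ZMod d) : ‖φ (neutralUnitary ζ b)‖ ≤ 1 := by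
  rw [neutralUnitary, map_smul, norm_smul, norm_prod,
    Finset.prod_congr rfl fun k _ => hζ.norm_gaussWeight (b k), Finset.prod_const_one, one_mul]
  exact hφ.norm_apply_mon_le _

variable {hζ : IsTwistRoot d ζ}

/-- Both entries belong to neutral pairs, so the transposition is a special case of the braid
exchange; adjacent transpositions then generate all permutations. -/
theorem IsBraidInvariant.apply_neutralUnitary_swap (hinv : IsBraidInvariant hζ φ) {n : ℕ}
    (i : Fin n) (b : Fin (n + 1) → ZMod d) :
    φ (neutralUnitary ζ (b ∘ Equiv.swap i.castSucc i.succ)) = φ (neutralUnitary ζ b) := by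
  rw [neutralUnitary, neutralUnitary, map_smul, map_smul]
  congr 1
  · exact Equiv.prod_comp (Equiv.swap i.castSucc i.succ) fun k => gaussWeight ζ (b k)
  have hne : i.castSucc ≠ i.succ := (Fin.castSucc_lt_succ (i := i)).ne
  set s : Finset (Fin (n + 1)) := {i.castSucc, i.succ} with hs
  have hsum (b : Fin (n + 1) → ZMod d) : neutralExponent b =
      (∑ k ∈ Finset.univ \ s, adjacentExponent (2 * (k : ℕ)) (b k)) +
        pairExponent i (b i.castSucc) (-b i.castSucc) +
        pairExponent (i + 1) (b i.succ) (-b i.succ) := by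
    rw [neutralExponent, ← Finset.sum_sdiff (Finset.subset_univ s), hs, Finset.sum_pair hne,
      pairExponent_neg_right, pairExponent_neg_right, add_assoc]
    rfl
  have hrest : ∑ k ∈ Finset.univ \ s, adjacentExponent (2 * (k : ℕ))
      ((b ∘ Equiv.swap i.castSucc i.succ) k) =
      ∑ k ∈ Finset.univ \ s, adjacentExponent (2 * (k : ℕ)) (b k) := by
    refine Finset.sum_congr rfl fun k hk => ?_
    simp only [hs, Finset.mem_sdiff, Finset.mem_insert, Finset.mem_singleton, not_or] at hk
    rw [Function.comp_apply, Equiv.swap_apply_of_ne_of_ne hk.2.1 hk.2.2]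
  have hv : VanishesAt (∑ k ∈ Finset.univ \ s, adjacentExponent (2 * (k : ℕ)) (b k)) i := by
    have h0 (j : ℕ) (hj : 2 * (i : ℕ) ≤ j ∧ j ≤ 2 * (i : ℕ) + 3) :
        (∑ k ∈ Finset.univ \ s, adjacentExponent (2 * (k : ℕ)) (b k)) j = 0 := by
      rw [Finsupp.finsetSum_apply]
      refine Finset.sum_eq_zero fun k hk => ?_
      simp only [hs, Finset.mem_sdiff, Finset.mem_insert, Finset.mem_singleton, not_or,
        Fin.ext_iff, Fin.val_castSucc, Fin.val_succ] at hk
      rw [← pairExponent_neg_right, pairExponent_apply_of_ne _ _ (by omega) (by omega)]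
    exact ⟨h0 _ (by omega), h0 _ (by omega), h0 _ (by omega), h0 _ (by omega)⟩
  rw [hsum, hsum b, hrest, Function.comp_apply, Function.comp_apply, Equiv.swap_apply_left,
    Equiv.swap_apply_right]
  exact hinv.apply_swap hv _ _ _

theorem IsBraidInvariant.apply_neutralUnitary_perm (hinv : IsBraidInvariant hζ φ) {n : ℕ}
    (σ : Equiv.Perm (Fin (n + 1))) (b : Fin (n + 1) → ZMod d) :
    φ (neutralUnitary ζ (b ∘ σ)) = φ (neutralUnitary ζ b) := by
  have hσ : σ ∈ Submonoid.closure
      (Set.range fun i : Fin n => Equiv.swap i.castSucc i.succ) := by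
    rw [Equiv.Perm.mclosure_swap_castSucc_succ]
    exact Submonoid.mem_top σ
  induction hσ using Submonoid.closure_induction generalizing b with
  | mem σ h =>
    obtain ⟨i, rfl⟩ := h
    exact hinv.apply_neutralUnitary_swap i b
  | one => rfl
  | mul σ τ _ _ hσ hτ =>
    rw [Equiv.Perm.coe_mul, ← Function.comp_assoc, hτ, hσ]

/-- The symmetric group acts transitively on injections, so `f` may be replaced by the initial
inclusion. -/
theorem IsBraidInvariant.apply_neutralUnitary_relocate (hinv : IsBraidInvariant hζ φ) {r n : ℕ}
    {f : Fin r → Fin (n + 1)} (hf : Function.Injective f) (a : Fin r → ZMod d) :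
    φ (neutralUnitary ζ (relocate f a)) = φ (neutralUnitary ζ a) := by
  have hr : r ≤ n + 1 := by simpa using Fintype.card_le_of_injective f hf
  obtain ⟨σ, hσ⟩ := (Equiv.Perm.isMultiplyPretransitive (Fin (n + 1)) r).exists_smul_eq
    ⟨Fin.castLE hr, Fin.castLE_injective hr⟩ ⟨f, hf⟩
  have h : f = σ ∘ Fin.castLE hr := by
    funext k
    exact (congrArg (fun e : Fin r ↪ Fin (n + 1) => e k) hσ).symm
  rw [← hinv.apply_neutralUnitary_perm σ, h, relocate_perm, neutralUnitary_relocate_castLE]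

end NeutralUnitaries

/-! ### The probability distribution of a state on characters -/

section SpectralWeights

variable {d : ℕ} [NeZero d] {ζ : ℂ} {φ : PF d ℕ →ₗ[ℂ] ℂ}

/-- A multiple of the spectral projection of the neutral unitaries for the character `t`. -/
noncomputable def spectralElement (ζ : ℂ) {n : ℕ} (t : Fin n → ZMod d) : PF d ℕ :=
  ∑ b : Fin n → ZMod d, (ZMod.stdAddChar (-∑ k, t k * b k) : ℂ) • neutralUnitary ζ b

/-- The element is self-adjoint, and multiplying it by a term of its own defining sum only shifts
the summation index; there are `d ^ n` terms. -/
theorem IsTwistRoot.star_mul_spectralElement (hζ : IsTwistRoot d ζ) {n : ℕ} (t : Fin n → ZMod d) :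
    star (spectralElement ζ t) * spectralElement ζ t = (d ^ n : ℂ) • spectralElement ζ t := by
  have hstar : star (spectralElement ζ t) = spectralElement ζ t := by
    rw [spectralElement, star_sum, ← Equiv.sum_comp (Equiv.neg _)]
    refine Finset.sum_congr rfl fun b _ => ?_
    rw [star_smul, hζ.star_neutralUnitary, star_stdAddChar]
    simp
  have hterm (b : Fin n → ZMod d) :
      (ZMod.stdAddChar (-∑ k, t k * b k) : ℂ) • neutralUnitary ζ b * spectralElement ζ t =
        spectralElement ζ t := by
    conv_rhs => rw [spectralElement, ← Equiv.sum_comp (Equiv.addLeft b)]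
    rw [spectralElement, Finset.mul_sum]
    refine Finset.sum_congr rfl fun b' _ => ?_
    rw [smul_mul_smul_comm, hζ.neutralUnitary_mul, ← AddChar.map_add_eq_mul, ← neg_add,
      ← Finset.sum_add_distrib]
    simp only [Equiv.coe_addLeft, Pi.add_apply, mul_add]
  rw [hstar]
  conv_lhs => rw [spectralElement, Finset.sum_mul]
  rw [← spectralElement, Finset.sum_congr rfl fun b _ => hterm b, Finset.sum_const,
    ← Nat.cast_smul_eq_nsmul ℂ]
  simp [ZMod.card]

theorem sum_stdAddChar_dot {n : ℕ} (s : Fin n → ZMod d) :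
    ∑ t : Fin n → ZMod d, (ZMod.stdAddChar (∑ k, t k * s k) : ℂ) =
      if s = 0 then (d ^ n : ℂ) else 0 := by
  have h : ∑ t : Fin n → ZMod d, (ZMod.stdAddChar (∑ k, t k * s k) : ℂ) =
      ∏ k, ∑ l : ZMod d, (ZMod.stdAddChar (l * s k) : ℂ) := by
    rw [Finset.prod_univ_sum, Fintype.piFinset_univ]
    exact Finset.sum_congr rfl fun t _ => stdAddChar_sum _ _
  rw [h]
  simp only [sum_stdAddChar_mul]
  split_ifs with hs
  · simp [hs]
  · obtain ⟨k, hk⟩ := Function.ne_iff.mp hs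
    exact Finset.prod_eq_zero (Finset.mem_univ k) (if_neg hk)

/-- The joint spectral distribution of the neutral unitaries in the state `φ`. -/
noncomputable def spectralWeight (ζ : ℂ) (φ : PF d ℕ →ₗ[ℂ] ℂ) {n : ℕ} (t : Fin n → ZMod d) : ℝ :=
  (φ (star (spectralElement ζ t) * spectralElement ζ t)).re / ((d : ℝ) ^ n) ^ 2

theorem IsState.spectralWeight_nonneg (hφ : IsState φ) {n : ℕ} (t : Fin n → ZMod d) :
    0 ≤ spectralWeight ζ φ t :=
  div_nonneg (Complex.nonneg_iff.mp (hφ.2 _)).1 (by positivity)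

/-- The defining quadratic expression shows positivity; this linear one permits Fourier inversion.
-/
theorem IsState.spectralWeight_eq (hφ : IsState φ) (hζ : IsTwistRoot d ζ) {n : ℕ}
    (t : Fin n → ZMod d) :
    (spectralWeight ζ φ t : ℂ) = φ (spectralElement ζ t) / (d : ℂ) ^ n := by
  have hd : (d : ℂ) ≠ 0 := Nat.cast_ne_zero.mpr (NeZero.ne d)
  have h1 : ((φ (star (spectralElement ζ t) * spectralElement ζ t)).re : ℂ) =
      φ (star (spectralElement ζ t) * spectralElement ζ t) :=
    (Complex.eq_re_of_ofReal_le (r := 0) (by simpa using hφ.2 (spectralElement ζ t))).symm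
  rw [spectralWeight, Complex.ofReal_div, h1, hζ.star_mul_spectralElement, map_smul, smul_eq_mul]
  push_cast
  field_simp

/-- Fourier inversion on `ZMod d ^ n`. -/
theorem IsState.apply_neutralUnitary_eq_sum (hφ : IsState φ) (hζ : IsTwistRoot d ζ) {n : ℕ}
    (b : Fin n → ZMod d) : φ (neutralUnitary ζ b) =
      ∑ t : Fin n → ZMod d, (spectralWeight ζ φ t : ℂ) * ZMod.stdAddChar (∑ k, t k * b k) := by
  have hd : (d : ℂ) ^ n ≠ 0 := pow_ne_zero _ (Nat.cast_ne_zero.mpr (NeZero.ne d))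
  have h1 (t : Fin n → ZMod d) :
      (spectralWeight ζ φ t : ℂ) * ZMod.stdAddChar (∑ k, t k * b k) =
        ∑ b' : Fin n → ZMod d, (ZMod.stdAddChar (∑ k, t k * (b - b') k) : ℂ) *
          (φ (neutralUnitary ζ b') / (d : ℂ) ^ n) := by
    rw [hφ.spectralWeight_eq hζ, spectralElement, map_sum, Finset.sum_div, Finset.sum_mul]
    refine Finset.sum_congr rfl fun b' _ => ?_
    have e : ∑ k, t k * (b - b') k = -∑ k, t k * b' k + ∑ k, t k * b k := by
      rw [neg_add_eq_sub, ← Finset.sum_sub_distrib]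
      exact Finset.sum_congr rfl fun k _ => by rw [Pi.sub_apply]; ring
    rw [e, AddChar.map_add_eq_mul, map_smul, smul_eq_mul]
    ring
  simp only [h1]
  rw [Finset.sum_comm]
  simp only [← Finset.sum_mul, sum_stdAddChar_dot, sub_eq_zero]
  simp only [ite_mul, zero_mul, Finset.sum_ite_eq, Finset.mem_univ, if_true]
  field_simp

theorem IsState.sum_spectralWeight (hφ : IsState φ) (hζ : IsTwistRoot d ζ) (n : ℕ) :
    ∑ t : Fin n → ZMod d, spectralWeight ζ φ t = 1 := by
  have h := hφ.apply_neutralUnitary_eq_sum hζ (0 : Fin n → ZMod d)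
  rw [neutralUnitary_zero, hφ.1] at h
  simp only [Pi.zero_apply, mul_zero, Finset.sum_const_zero, AddChar.map_zero_eq_one,
    mul_one] at h
  exact_mod_cast h.symm

end SpectralWeights

/-! ### States of one pair built from characters -/

section CharacterStates

variable {d : ℕ} [NeZero d] {ζ : ℂ}

/-- The neutral state on `PF_2` whose restriction to the neutral part is the character `s`. -/
noncomputable def characterState (ζ : ℂ) (s : ZMod d) : PF d (Fin 2) →ₗ[ℂ] ℂ :=
  functional fun a =>
    if a 0 + a 1 = 0 then (starRingEnd ℂ) (gaussWeight ζ (a 0)) * ZMod.stdAddChar (s * a 0) else 0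

theorem isNeutral_of_apply_mon {ρ : PF d (Fin 2) →ₗ[ℂ] ℂ}
    (h : ∀ a : Fin 2 →₀ ZMod d, a 0 + a 1 ≠ 0 → ρ (monomial a 1) = 0) : IsNeutral ρ := by
  intro q hq x hx
  induction hx using Submodule.span_induction with
  | zero => exact map_zero ρ
  | add x y _ _ hx hy => rw [map_add, hx, hy, add_zero]
  | smul a x _ hx => rw [map_smul, hx, smul_zero]
  | mem x hx =>
    obtain ⟨m, hm, rfl⟩ := hx
    rw [Finsupp.sum_fintype _ _ (fun _ => rfl), Fin.sum_univ_two] at hm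
    exact h m (hm ▸ hq)

theorem isState_of_gram_eq_sum {ι : Type} [LinearOrder ι] {κ : Type*} [Fintype κ]
    {φ : PF d ι →ₗ[ℂ] ℂ} (h1 : φ 1 = 1) (u : κ → (ι →₀ ZMod d) → ℂ)
    (h : ∀ m n, gram φ m n = ∑ s, star (u s m) * u s n) : IsState φ := by
  refine isState_of_posSemidef_gram h1 fun x => ?_
  have e : (x.sum fun m a => x.sum fun n b => star a * gram φ m n * b) =
      ∑ s, star (∑ m ∈ x.support, u s m * x m) * ∑ m ∈ x.support, u s m * x m := by
    simp only [Finsupp.sum, h, star_sum, Finset.sum_mul_sum]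
    conv_rhs => rw [Finset.sum_comm]
    refine Finset.sum_congr rfl fun m _ => ?_
    conv_rhs => rw [Finset.sum_comm]
    refine Finset.sum_congr rfl fun n _ => ?_
    rw [Finset.mul_sum, Finset.sum_mul]
    refine Finset.sum_congr rfl fun s _ => ?_
    rw [star_mul']
    ring
  rw [e]
  exact Finset.sum_nonneg fun s _ => star_mul_self_nonneg _

/-- The Gram matrix is block diagonal in the charge `κ = a 0 + a 1`, and each block has rank one.
With `a 1 = κ - a 0`, the reordering phase splits into a part linear in `κ`, which shifts the
character `s` to `κ + s`, and a part absorbed by the Gauss weights. -/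
theorem IsTwistRoot.isState_characterState (hζ : IsTwistRoot d ζ) (s : ZMod d) :
    IsState (characterState ζ s) := by
  refine isState_of_gram_eq_sum ?_ (fun κ a => if a 0 + a 1 = κ then
    (starRingEnd ℂ) (gaussWeight ζ (a 0)) * ZMod.stdAddChar ((κ + s) * a 0) else 0) ?_
  · rw [one_def, characterState, functional_mon]
    simp [gaussWeight_zero]
  · intro a b
    rw [gram_eq, characterState, functional_mon, reorderExponent_fin_two, Finset.sum_eq_single
      (a 0 + a 1)]
    · rw [if_pos rfl]
      by_cases h : b 0 + b 1 = a 0 + a 1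
      · have h' : (b - a) 0 + (b - a) 1 = 0 := by
          rw [Finsupp.sub_apply, Finsupp.sub_apply]
          linear_combination h
        rw [if_pos h, if_pos h', star_mul', star_stdAddChar]
        simp only [Finsupp.sub_apply]
        have hg := hζ.gaussWeight_add (a 0) (b 0 - a 0)
        rw [add_sub_cancel] at hg
        have hc : (starRingEnd ℂ) (ZMod.stdAddChar (a 0 * (b 0 - a 0)) : ℂ) =
          ZMod.stdAddChar (-(a 0 * (b 0 - a 0))) := star_stdAddChar _
        have e1 : (ZMod.stdAddChar (-((a 0 + a 1 + s) * a 0)) : ℂ) *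
            ZMod.stdAddChar (-(a 0 * (b 0 - a 0))) * ZMod.stdAddChar ((a 0 + a 1 + s) * b 0) =
            ZMod.stdAddChar (-(a 1 * (a 0 - b 0))) * ZMod.stdAddChar (s * (b 0 - a 0)) := by
          rw [← AddChar.map_add_eq_mul, ← AddChar.map_add_eq_mul, ← AddChar.map_add_eq_mul]
          congr 1
          ring
        rw [hg, map_mul (starRingEnd ℂ), map_mul (starRingEnd ℂ), hc, Complex.star_def, Complex.conj_conj]
        linear_combination (-(gaussWeight ζ (a 0) * (starRingEnd ℂ) (gaussWeight ζ (a 0)) *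
          (starRingEnd ℂ) (gaussWeight ζ (b 0 - a 0)))) * e1 -
          (ZMod.stdAddChar (-(a 1 * (a 0 - b 0))) * ZMod.stdAddChar (s * (b 0 - a 0)) *
          (starRingEnd ℂ) (gaussWeight ζ (b 0 - a 0))) * hζ.gaussWeight_mul_conj (a 0)
      · have h' : ¬ (b - a) 0 + (b - a) 1 = 0 := by
          rw [Finsupp.sub_apply, Finsupp.sub_apply]
          exact fun h' => h (by linear_combination h')
        rw [if_neg h, if_neg h', mul_zero, mul_zero]
    · intro κ _ hκ
      rw [if_neg hκ.symm, star_zero, zero_mul]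
    · simp

/-- The uniform mixture of the character states of a sequence of characters. -/
noncomputable def empiricalState (ζ : ℂ) {n : ℕ} (t : Fin n → ZMod d) : PF d (Fin 2) →ₗ[ℂ] ℂ :=
  (n : ℂ)⁻¹ • ∑ j, characterState ζ (t j)

theorem empiricalState_apply {n : ℕ} (t : Fin n → ZMod d) (x : PF d (Fin 2)) :
    empiricalState ζ t x = (n : ℂ)⁻¹ * ∑ j, characterState ζ (t j) x := by
  rw [empiricalState, LinearMap.smul_apply, LinearMap.sum_apply, smul_eq_mul]

theorem empiricalState_mon_of_charged {n : ℕ} (t : Fin n → ZMod d) {a : Fin 2 →₀ ZMod d}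
    (h : a 0 + a 1 ≠ 0) : empiricalState ζ t (monomial a 1) = 0 := by
  rw [empiricalState_apply, Finset.sum_eq_zero, mul_zero]
  intro j _
  rw [characterState, functional_mon, if_neg h]

theorem empiricalState_mon_of_neutral {n : ℕ} (t : Fin n → ZMod d) {a : Fin 2 →₀ ZMod d}
    (h : a 0 + a 1 = 0) : empiricalState ζ t (monomial a 1) =
      (starRingEnd ℂ) (gaussWeight ζ (a 0)) *
        ((n : ℂ)⁻¹ * ∑ j, (ZMod.stdAddChar (t j * a 0) : ℂ)) := by
  rw [empiricalState_apply, mul_left_comm]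
  congr 1
  rw [Finset.mul_sum]
  refine Finset.sum_congr rfl fun j _ => ?_
  rw [characterState, functional_mon, if_pos h]

theorem isNeutral_empiricalState {n : ℕ} (t : Fin n → ZMod d) :
    IsNeutral (empiricalState ζ t) :=
  isNeutral_of_apply_mon fun _ h => empiricalState_mon_of_charged t h

theorem IsTwistRoot.isState_empiricalState (hζ : IsTwistRoot d ζ) {n : ℕ} (hn : n ≠ 0)
    (t : Fin n → ZMod d) : IsState (empiricalState ζ t) := by
  have hn' : (n : ℂ) ≠ 0 := Nat.cast_ne_zero.mpr hn
  refine ⟨?_, fun x => ?_⟩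
  · rw [empiricalState_apply, Finset.sum_congr rfl fun j _ => (hζ.isState_characterState (t j)).1]
    simp [hn']
  · rw [empiricalState_apply]
    refine mul_nonneg ?_ (Finset.sum_nonneg fun j _ => (hζ.isState_characterState (t j)).2 x)
    simp

end CharacterStates

/-! ### Approximation by mixtures of empirical product states -/

section DeFinetti

open Filter Topology

variable {d : ℕ} [NeZero d] {ζ : ℂ} {φ : PF d ℕ →ₗ[ℂ] ℂ}

/-- The mixture of product states given by the empirical states of the first `n` pairs. -/
noncomputable def empiricalMixture (ζ : ℂ) (φ : PF d ℕ →ₗ[ℂ] ℂ) (n : ℕ) : PF d ℕ →ₗ[ℂ] ℂ :=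
  ∑ t : Fin n → ZMod d, (spectralWeight ζ φ t : ℂ) • infiniteProduct (empiricalState ζ t)

theorem empiricalMixture_apply (n : ℕ) (x : PF d ℕ) : empiricalMixture ζ φ n x =
    ∑ t : Fin n → ZMod d, (spectralWeight ζ φ t : ℂ) * infiniteProduct (empiricalState ζ t) x := by
  rw [empiricalMixture, LinearMap.sum_apply]
  rfl

theorem empiricalMixture_mem_convexHull (hφ : IsState φ) (hζ : IsTwistRoot d ζ) {n : ℕ}
    (hn : n ≠ 0) :
    (empiricalMixture ζ φ n : PF d ℕ → ℂ) ∈ convexHull ℝ (neutralProductStates d) := by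
  have h := (convex_convexHull ℝ (neutralProductStates d)).sum_mem (t := Finset.univ)
    (w := fun t : Fin n → ZMod d => spectralWeight ζ φ t)
    (z := fun t => (infiniteProduct (empiricalState ζ t) : PF d ℕ → ℂ))
    (fun t _ => hφ.spectralWeight_nonneg t) (hφ.sum_spectralWeight hζ n)
    (fun t _ => subset_convexHull ℝ _ (infiniteProduct_mem_neutralProductStates
      (hζ.isState_empiricalState hn t) (isNeutral_empiricalState t)))
  convert h using 1
  funext x
  rw [empiricalMixture_apply, Finset.sum_apply]
  exact Finset.sum_congr rfl fun t _ => (Complex.real_smul).symm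

theorem empiricalMixture_mon_of_charged (hζ : IsTwistRoot d ζ) {n : ℕ} (hn : n ≠ 0)
    {m : ℕ →₀ ZMod d} {k : ℕ} (hk : m (2 * k) + m (2 * k + 1) ≠ 0) :
    empiricalMixture ζ φ n (monomial m 1) = 0 := by
  obtain ⟨N, hN⟩ := exists_pairBound m
  have hkN : k ∈ Finset.range N := by
    rw [Finset.mem_range]
    by_contra! h
    exact hk (by rw [hN _ (by omega), hN _ (by omega), add_zero])
  rw [empiricalMixture_apply]
  refine Finset.sum_eq_zero fun t _ => ?_
  rw [infiniteProduct_mon (hζ.isState_empiricalState hn t).1 hN,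
    Finset.prod_eq_zero hkN (empiricalState_mon_of_charged t hk), mul_zero]

/-- A product of `r` averages over `Fin n` is an average over all maps `f : Fin r → Fin n`. For
fixed `f`, summing the characters against the spectral weights returns the value of `φ` on the
relocated unitary. -/
theorem empiricalMixture_mon_of_neutral (hφ : IsState φ) (hζ : IsTwistRoot d ζ) {n : ℕ}
    (hn : n ≠ 0) {m : ℕ →₀ ZMod d} (hm : ∀ k, m (2 * k) + m (2 * k + 1) = 0) {r : ℕ}
    (hr : ∀ j, 2 * r ≤ j → m j = 0) :
    empiricalMixture ζ φ n (monomial m 1) =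
      (∏ k : Fin r, (starRingEnd ℂ) (gaussWeight ζ (m (2 * k)))) *
        (((n : ℂ) ^ r)⁻¹ * ∑ f : Fin r → Fin n,
          φ (neutralUnitary ζ (relocate f fun k : Fin r => m (2 * k)))) := by
  have h1 (t : Fin n → ZMod d) : infiniteProduct (empiricalState ζ t) (monomial m 1) =
      (∏ k : Fin r, (starRingEnd ℂ) (gaussWeight ζ (m (2 * k)))) *
        (((n : ℂ) ^ r)⁻¹ * ∑ f : Fin r → Fin n,
          (ZMod.stdAddChar (∑ j, t j * relocate f (fun k : Fin r => m (2 * k)) j) : ℂ)) := by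
    rw [infiniteProduct_mon (hζ.isState_empiricalState hn t).1 hr, Finset.prod_range,
      Finset.prod_congr rfl fun (k : Fin r) _ => empiricalState_mon_of_neutral t (hm k),
      Finset.prod_mul_distrib, Finset.prod_mul_distrib, Finset.prod_univ_sum,
      Fintype.piFinset_univ]
    simp only [sum_mul_relocate, stdAddChar_sum, pairRestrict_zero_apply]
    simp
  rw [empiricalMixture_apply]
  simp only [h1, hφ.apply_neutralUnitary_eq_sum hζ]
  simp only [Finset.mul_sum]
  rw [Finset.sum_comm]
  refine Finset.sum_congr rfl fun f _ => Finset.sum_congr rfl fun t _ => ?_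
  ring

theorem IsTwistRoot.apply_mon_of_neutral (hζ : IsTwistRoot d ζ) (φ : PF d ℕ →ₗ[ℂ] ℂ)
    {m : ℕ →₀ ZMod d} (hm : ∀ k, m (2 * k) + m (2 * k + 1) = 0) {r : ℕ}
    (hr : ∀ j, 2 * r ≤ j → m j = 0) :
    φ (monomial m 1) = (∏ k : Fin r, (starRingEnd ℂ) (gaussWeight ζ (m (2 * k)))) *
      φ (neutralUnitary ζ fun k : Fin r => m (2 * k)) := by
  have e : neutralExponent (fun k : Fin r => m (2 * k)) = m := by
    conv_rhs => rw [eq_sum_adjacent hm hr, Finset.sum_range]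
    rfl
  rw [neutralUnitary, e, map_smul, smul_eq_mul, ← mul_assoc, ← Finset.prod_mul_distrib,
    Finset.prod_eq_one, one_mul]
  intro k _
  rw [mul_comm]
  exact hζ.gaussWeight_mul_conj _

/-- Averages over all maps `Fin r → Fin n` are dominated by the injective maps. -/
theorem tendsto_average_of_injective {r : ℕ} (F : (n : ℕ) → (Fin r → Fin n) → ℂ) (z : ℂ)
    (hF : ∀ n f, ‖F n f‖ ≤ 1) (hz : ‖z‖ ≤ 1)
    (h : ∀ n f, Function.Injective f → F n f = z) :
    Tendsto (fun n : ℕ => ((n : ℂ) ^ r)⁻¹ * ∑ f, F n f) atTop (𝓝 z) := by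
  classical
  -- The fraction of non-injective maps is `1 - n.descFactorial r / n ^ r`, and each of them
  -- contributes an error of at most `2`.
  have hlim : Tendsto (fun n : ℕ => 2 * (1 - (n.descFactorial r : ℝ) / (n : ℝ) ^ r)) atTop
      (𝓝 0) := by
    have h1 : Tendsto (fun n : ℕ => (n.descFactorial r : ℝ) / (n : ℝ) ^ r) atTop (𝓝 1) := by
      refine (Asymptotics.isEquivalent_iff_tendsto_one ?_).mp (isEquivalent_descFactorial r)
      filter_upwards [eventually_ne_atTop 0] with n hn
      exact pow_ne_zero _ (Nat.cast_ne_zero.mpr hn)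
    simpa using (h1.const_sub 1).const_mul 2
  rw [tendsto_iff_norm_sub_tendsto_zero]
  refine squeeze_zero' (Eventually.of_forall fun _ => norm_nonneg _) ?_ hlim
  filter_upwards [eventually_ne_atTop 0] with n hn
  have hn' : (n : ℂ) ^ r ≠ 0 := pow_ne_zero _ (Nat.cast_ne_zero.mpr hn)
  have hn'' : (0 : ℝ) < (n : ℝ) ^ r := pow_pos (Nat.cast_pos.mpr (Nat.pos_of_ne_zero hn)) _
  have hcard : (Fintype.card (Fin r → Fin n) : ℝ) = (n : ℝ) ^ r := by simp
  have hcard' : (Fintype.card (Fin r → Fin n) : ℂ) = (n : ℂ) ^ r := by simp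
  have hinj : ((Finset.univ.filter fun f : Fin r → Fin n => Function.Injective f).card : ℝ) =
      n.descFactorial r := by
    rw [← Fintype.card_subtype, Fintype.card_congr (Equiv.subtypeInjectiveEquivEmbedding _ _),
      Fintype.card_embedding_eq, Fintype.card_fin, Fintype.card_fin]
  have e : ((n : ℂ) ^ r)⁻¹ * ∑ f, F n f - z = ((n : ℂ) ^ r)⁻¹ * ∑ f, (F n f - z) := by
    rw [Finset.sum_sub_distrib, mul_sub, Finset.sum_const, Finset.card_univ, nsmul_eq_mul,
      hcard', inv_mul_cancel_left₀ hn']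
  have hb : ‖∑ f, (F n f - z)‖ ≤ 2 * ((n : ℝ) ^ r - n.descFactorial r) := by
    have hsplit := Finset.card_filter_add_card_filter_not (s := Finset.univ)
      (fun f : Fin r → Fin n => Function.Injective f)
    have hsplit' : ((Finset.univ.filter fun f : Fin r → Fin n => ¬ Function.Injective f).card : ℝ)
        = (n : ℝ) ^ r - n.descFactorial r := by
      rw [← hcard, ← hinj, ← Finset.card_univ, ← hsplit]
      push_cast
      ring
    calc _ = ‖∑ f ∈ Finset.univ.filter fun f : Fin r → Fin n => ¬ Function.Injective f,
          (F n f - z)‖ := by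
          congr 1
          refine (Finset.sum_subset (Finset.subset_univ _) fun f _ hf => ?_).symm
          rw [Finset.mem_filter, not_and, not_not] at hf
          rw [h n f (hf (Finset.mem_univ f)), sub_self]
      _ ≤ ∑ f ∈ Finset.univ.filter fun f : Fin r → Fin n => ¬ Function.Injective f, 2 := by
          refine norm_sum_le_of_le _ fun f _ => (norm_sub_le _ _).trans ?_
          linarith [hF n f]
      _ = _ := by
          rw [Finset.sum_const, nsmul_eq_mul, hsplit']
          ring
  rw [e, norm_mul, norm_inv, norm_pow, Complex.norm_natCast, inv_mul_le_iff₀ hn'']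
  refine hb.trans (le_of_eq ?_)
  field_simp

/-- On monomials with a charged pair both sides vanish; on the others exchangeability identifies the
terms of all injective maps. The index is `n + 1` because an empirical state needs at least one
sample. -/
theorem tendsto_empiricalMixture (hd : Squarefree d) {hζ : IsTwistRoot d ζ} (hφ : IsState φ)
    (hinv : IsBraidInvariant hζ φ) (x : PF d ℕ) :
    Tendsto (fun n => empiricalMixture ζ φ (n + 1) x) atTop (𝓝 (φ x)) := by
  induction x using induction_on with
  | h0 => simp
  | hadd x y hx hy =>
    simp only [map_add]
    exact hx.add hy
  | hm m a =>
    rw [monomial_eq_smul]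
    simp only [map_smul, smul_eq_mul]
    refine Tendsto.const_mul a ?_
    by_cases hm : ∀ k, m (2 * k) + m (2 * k + 1) = 0
    · obtain ⟨r, hr⟩ := exists_pairBound m
      rw [hζ.apply_mon_of_neutral φ hm hr]
      simp only [empiricalMixture_mon_of_neutral hφ hζ (Nat.succ_ne_zero _) hm hr]
      refine Tendsto.const_mul _ ?_
      have h := tendsto_average_of_injective (r := r)
        (fun n f => φ (neutralUnitary ζ (relocate f fun k : Fin r => m (2 * k))))
        (φ (neutralUnitary ζ fun k : Fin r => m (2 * k)))
        (fun n f => hφ.norm_apply_neutralUnitary_le hζ _)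
        (hφ.norm_apply_neutralUnitary_le hζ _) (fun n f hf => ?_)
      · exact h.comp (tendsto_add_atTop_nat 1)
      -- The relocation lemma concerns `Fin (n + 1)`; over `Fin 0` a map exists only for `r = 0`,
      -- where both unitaries are `1`.
      · cases n with
        | zero =>
          cases r with
          | zero =>
            rw [Subsingleton.elim (relocate f _) 0, neutralUnitary_zero,
              Subsingleton.elim (fun k : Fin 0 => m (2 * k)) 0, neutralUnitary_zero]
          | succ r => exact (f 0).elim0
        | succ n => exact hinv.apply_neutralUnitary_relocate hf _
    · push Not at hm
      obtain ⟨k, hk⟩ := hm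
      rw [apply_eq_zero_of_charged hd hφ hinv hk]
      simp only [empiricalMixture_mon_of_charged hζ (Nat.succ_ne_zero _) hk]
      exact tendsto_const_nhds

end DeFinetti

end PF

/-- The closure is taken for pointwise convergence on `PF_∞`, that is, in the weak* topology. -/
theorem mainTheorem5 (d : ℕ) [NeZero d] (hd : Squarefree d) (ζ : ℂ) (hζ : PF.IsTwistRoot d ζ)
    (φ : PF d ℕ →ₗ[ℂ] ℂ) (hφ : PF.IsState φ) (hinv : PF.IsBraidInvariant hζ φ) :
    PF.IsNeutral φ ∧ (φ : PF d ℕ → ℂ) ∈ closure (convexHull ℝ (PF.neutralProductStates d)) :=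
  ⟨hinv.isNeutral hd hφ, mem_closure_of_tendsto
    (tendsto_pi_nhds.mpr (PF.tendsto_empiricalMixture hd hφ hinv))
    (Filter.Eventually.of_forall fun n =>
      PF.empiricalMixture_mem_convexHull hφ hζ (Nat.succ_ne_zero n))⟩
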